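/- **Theorem 4.1** (a theorem of ZF; the Axiom of Choice is not assumed). A *tree* is a set $T$ of functions whose domains are ordinals, such that $f\restriction\alpha\in T$ whenever $f\in T$ and $\alpha\in\operatorname{dom}(f)$; a *branch* of $T$ is a set of pairwise $\subseteq$-comparable elements of $T$, and it is *maximal* if it is not properly contained in another branch. For an ordinal $\gamma$, $\mathrm{DC}_\gamma$ is the statement that, for every set $X$, every tree $T$ of functions from ordinals less than $\gamma$ into $X$ has a maximal branch. Let $C^\lambda_{\{\theta\}}$ be the set of ordinals $\delta<\lambda$ with $\operatorname{cf}(\delta)=\theta$. Let $\theta<\lambda$ be (infinite) regular cardinals with $\theta^+<\lambda$, and suppose that $\mathrm{DC}_{\theta^+}$ holds. Suppose that $\langle c_\delta:\delta\in C^\lambda_{\{\theta\}}\rangle$ is a sequence such that each $c_\delta$ is a closed cofinal subset of $\delta$ of ordertype less than $\theta^+$. Then the following hold. 1. There exists a sequence $\langle d_\delta:\delta\in C^\lambda_{\{\theta\}}\rangle$ such that each $d_\delta$ is a cofinal subset of $\delta$, and such that for every closed unbounded $D\subseteq\lambda$ there is a $\delta\in C^\lambda_{\{\theta\}}$ with $d_\delta\subseteq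 D$. 2. If $\theta$ is uncountable, then there exists a sequence $\langle d_\delta:\delta\in C^\lambda_{\{\theta\}}\rangle$ such that each $d_\delta$ is a closed cofinal subset of $c_\delta$, and such that for every closed unbounded $D\subseteq\lambda$ there is a $\delta\in C^\lambda_{\{\theta\}}$ with $d_\delta\subseteq D$. -/

import Mathlib

/-!
Models of first-order ZF set theory and the set-theoretic notions of such a model.
A statement is a theorem of ZF exactly when it holds in every model of ZF, so a theorem of ZF is
stated here for an arbitrary model `M`. Nothing is assumed about `M` beyond the ZF axioms: no form of
choice, no well-foundedness or standardness seen from outside. All notions below (ordinals,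
functions, cofinality, ...) are those of `M`: every quantifier ranges over elements of `M`.
-/

namespace ZFModel

open FirstOrder

/-- The only symbol of the language of set theory: a binary relation symbol. -/
inductive MemSymbol : ℕ → Type
  | mem : MemSymbol 2

/-- The first-order language of set theory. -/
def setLanguage : Language := ⟨fun _ => Empty, MemSymbol⟩

/-- A type with a membership relation is a structure for the language of set theory. -/
instance memStructure {M : Type*} [Membership M M] : setLanguage.Structure M where
  funMap := fun f => Empty.elim f
  RelMap := fun r v => match r, v with
    | MemSymbol.mem, v => v 0 ∈ v 1

section Notions

variable {M : Type*} [Membership M M]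

/-- `x ⊆ y`. -/
def IsSubset (x y : M) : Prop := ∀ z ∈ x, z ∈ y

/-- `p = {x, y}`. -/
def IsPair (x y p : M) : Prop := ∀ z, z ∈ p ↔ z = x ∨ z = y

/-- `s = x ∪ {x}`. -/
def IsSucc (x s : M) : Prop := ∀ z, z ∈ s ↔ z ∈ x ∨ z = x

variable (M) in
/-- `(M, ∈)` satisfies the axioms of ZF. Separation and replacement are the usual
first-order schemes: one instance for every formula `φ` and all parameters `p` in `M`. -/
structure ModelsZF : Prop where
  extensionality : ∀ x y : M, (∀ z, z ∈ x ↔ z ∈ y) → x = y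
  foundation : ∀ x : M, (∃ y, y ∈ x) → ∃ y : M, y ∈ x ∧ ∀ z ∈ y, ¬ z ∈ x
  pairing : ∀ x y : M, ∃ p, IsPair x y p
  union : ∀ x : M, ∃ u : M, ∀ z : M, z ∈ u ↔ ∃ y, y ∈ x ∧ z ∈ y
  powerset : ∀ x : M, ∃ p : M, ∀ z : M, z ∈ p ↔ IsSubset z x
  infinity : ∃ w : M, (∃ e ∈ w, ∀ z : M, ¬ z ∈ e) ∧ ∀ x ∈ w, ∃ s ∈ w, IsSucc x s
  separation : ∀ (n : ℕ) (φ : setLanguage.Formula (Fin (n + 1))) (p : Fin n → M) (a : M),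
    ∃ b : M, ∀ x, x ∈ b ↔ x ∈ a ∧ φ.Realize (Fin.cons x p : Fin (n + 1) → M)
  replacement : ∀ (n : ℕ) (φ : setLanguage.Formula (Fin (n + 2))) (p : Fin n → M) (a : M),
    (∀ x ∈ a, ∀ y z : M,
      φ.Realize (Fin.cons x (Fin.cons y p : Fin (n + 1) → M) : Fin (n + 2) → M) →
      φ.Realize (Fin.cons x (Fin.cons z p : Fin (n + 1) → M) : Fin (n + 2) → M) → y = z) →
    ∃ b : M, ∀ y, y ∈ b ↔
      ∃ x ∈ a, φ.Realize (Fin.cons x (Fin.cons y p : Fin (n + 1) → M) : Fin (n + 2) → M)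

/-! ### Functions -/

/-- `p` is the Kuratowski pair `(x, y) = {{x}, {x, y}}`. -/
def IsOrdPair (x y p : M) : Prop := ∃ a b, IsPair x x a ∧ IsPair x y b ∧ IsPair a b p

/-- `(x, y) ∈ f`; when `f` is a function this says `f(x) = y`. -/
def App (f x y : M) : Prop := ∃ p ∈ f, IsOrdPair x y p

/-- `f` is a function: a single-valued set of ordered pairs. -/
def IsFunction (f : M) : Prop :=
  (∀ p ∈ f, ∃ x y, IsOrdPair x y p) ∧ ∀ x y z, App f x y → App f x z → y = z

/-- `a` is the domain of `f`. -/
def IsDomain (f a : M) : Prop := ∀ x, x ∈ a ↔ ∃ y, App f x y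

/-- `f` is a sequence indexed by `S`, i.e. a function with domain `S`. -/
def IsSeqOn (f S : M) : Prop := IsFunction f ∧ IsDomain f S

/-- `f : a → b`. -/
def IsMap (f a b : M) : Prop := IsSeqOn f a ∧ ∀ x y, App f x y → y ∈ b

/-- `f` is an injection from `a` into `b`. -/
def IsInjection (f a b : M) : Prop :=
  IsMap f a b ∧ ∀ x x' y, App f x y → App f x' y → x = x'

/-- `f` is a bijection from `a` onto `b`. -/
def IsBijection (f a b : M) : Prop := IsInjection f a b ∧ ∀ y ∈ b, ∃ x, App f x y

/-- `g` is the restriction of `f` to `a`. -/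
def IsRestriction (f a g : M) : Prop := ∀ p, p ∈ g ↔ p ∈ f ∧ ∃ x ∈ a, ∃ y, IsOrdPair x y p

/-! ### Ordinals and cardinals -/

/-- `x` is a transitive set. -/
def IsTransitive (x : M) : Prop := ∀ y ∈ x, IsSubset y x

/-- `α` is a (von Neumann) ordinal: a transitive set of transitive sets. Ordinals are ordered
by membership. -/
def IsOrdinal (α : M) : Prop := IsTransitive α ∧ ∀ β ∈ α, IsTransitive β

/-- `α` is a nonzero limit ordinal. -/
def IsLimitOrdinal (α : M) : Prop :=
  IsOrdinal α ∧ (∃ β, β ∈ α) ∧ ∀ β ∈ α, ∃ γ ∈ α, β ∈ γ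

/-- `w` is `ω`, the least nonzero limit ordinal. -/
def IsOmega (w : M) : Prop := IsLimitOrdinal w ∧ ∀ α ∈ w, ¬ IsLimitOrdinal α

/-- `x` is uncountable: there is no injection of `x` into `ω`. -/
def IsUncountable (x : M) : Prop := ∀ w f : M, IsOmega w → ¬ IsInjection f x w

/-- `κ` is a cardinal: an ordinal not in bijection with any smaller ordinal. -/
def IsCardinal (κ : M) : Prop := IsOrdinal κ ∧ ∀ α ∈ κ, ∀ f, ¬ IsBijection f α κ

/-- `μ = κ⁺`, the least cardinal greater than `κ`. -/
def IsSuccCardinal (κ μ : M) : Prop :=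
  IsCardinal μ ∧ κ ∈ μ ∧ ∀ ν ∈ μ, κ ∈ ν → ¬ IsCardinal ν

/-- The ordinal `η` is the order type of the set of ordinals `x`. -/
def IsOrderType (x η : M) : Prop :=
  IsOrdinal η ∧ ∃ f, IsBijection f η x ∧
    ∀ α β u v, App f α u → App f β v → α ∈ β → u ∈ v

/-- `x` is a cofinal subset of the ordinal `δ`. -/
def IsCofinalIn (x δ : M) : Prop := IsSubset x δ ∧ ∀ α ∈ δ, ∃ β ∈ x, α ∈ β ∨ α = β

/-- `x` contains each of its limit points below the ordinal `δ`. -/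
def IsClosedIn (x δ : M) : Prop :=
  ∀ α ∈ δ, (∃ β, β ∈ α) → (∀ β ∈ α, ∃ γ ∈ x, γ ∈ α ∧ β ∈ γ) → α ∈ x

/-- `x` is a closed cofinal subset (a club) of the ordinal `δ`. -/
def IsClubIn (x δ : M) : Prop := IsCofinalIn x δ ∧ IsClosedIn x δ

/-- `κ = cf(δ)`: the least order type of a cofinal subset of `δ`. -/
def IsCofinality (δ κ : M) : Prop :=
  (∃ x, IsCofinalIn x δ ∧ IsOrderType x κ) ∧
    ∀ η ∈ κ, ∀ x, IsCofinalIn x δ → ¬ IsOrderType x η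

/-- `κ` is a regular cardinal: an infinite cardinal with `cf(κ) = κ`. (A cardinal is infinite
iff it is a nonzero limit ordinal.) -/
def IsRegularCardinal (κ : M) : Prop := IsCardinal κ ∧ IsLimitOrdinal κ ∧ IsCofinality κ κ

/-- `S` is the set of all ordinals below `lam` of cofinality `θ`. -/
def IsCofinalitySet (lam θ S : M) : Prop := ∀ δ, δ ∈ S ↔ δ ∈ lam ∧ IsCofinality δ θ

/-! ### Dependent choice -/

/-- `T` is a tree: a set of functions with ordinal domains, closed under restriction to
the elements of the domain. -/
def IsTree (T : M) : Prop :=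
  ∀ f ∈ T, ∃ η, IsOrdinal η ∧ IsSeqOn f η ∧ ∀ α ∈ η, ∃ g ∈ T, IsRestriction f α g

/-- `b` is a branch of `T`: a set of pairwise compatible elements of `T`. -/
def IsBranch (b T : M) : Prop := IsSubset b T ∧ ∀ f ∈ b, ∀ g ∈ b, IsSubset f g ∨ IsSubset g f

/-- `b` is a branch of `T` not properly contained in any other branch. -/
def IsMaximalBranch (b T : M) : Prop :=
  IsBranch b T ∧ ∀ b', IsBranch b' T → IsSubset b b' → b' = b

/-- `DC_γ`: for every set `X`, every tree of functions from ordinals less than `γ` to `X`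
has a maximal branch. -/
def DependentChoice (γ : M) : Prop :=
  ∀ X T : M, IsTree T → (∀ f ∈ T, ∃ η ∈ γ, IsMap f η X) → ∃ b, IsMaximalBranch b T

/-! ### Club guessing -/

/-- The sequence `d`, indexed by `S`, guesses clubs of `lam`: every club of `lam` contains
some `d(δ)` as a subset. -/
def GuessesClubs (d S lam : M) : Prop :=
  ∀ D, IsClubIn D lam → ∃ δ ∈ S, ∃ x, App d δ x ∧ IsSubset x D

end Notions

end ZFModel

open ZFModel

/-! Suppose that a rule E ↦ ⟨d(E, δ) : δ ∈ S⟩ attaches to every club E of λ an admissible sequence,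
and that none of these sequences guesses clubs. Using `DependentChoice`, choose clubs D_α for α < θ⁺
such that D_α defeats the sequence of E_α = ⋂_{β<α} D_β. As θ⁺ < λ, all these intersections are
clubs, and some δ of cofinality θ is a limit point of all of them at once
(`exists_counterexamples`). So d(E_α, δ) ⊄ D_α for every α < θ⁺, and this must be refuted using only
that c_δ has order type less than θ⁺.

If θ is uncountable, let d(E, δ) = c_δ ∩ E at limit points δ of E. The least x_α ∈ c_δ ∩ E_α outside
D_α differs from every later x_β, since x_β ∈ E_β ⊆ D_α. Hence θ⁺ injects into c_δ, which is too
small.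

If θ = ω, then c_δ ∩ E may fail to be cofinal, so each γ ∈ c_δ is dropped to max(E ∩ (γ + 1)). For
each α some γ drops to a point of E_α outside D_α. For a fixed γ these drops strictly decrease with
α, so only finitely many α use that γ. As c_δ is countable, ω₁ maps to ω with finite fibres.
Ordering ω₁ by fibre and then by size enumerates it in type at most ω, without choice
(`inj_omega_of_finite_fibres`), a contradiction.

All other selections take least ordinals. Since M is an arbitrary model, separation, replacement,
induction and recursion apply only to predicates and functions definable with parameters. The
classes `DefProp` and `DefFun` let instance search supply the formulas. -/

set_option linter.unusedSectionVars false

namespace ZFModel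

open FirstOrder

universe u

/-! ### Definability with parameters -/

section Definability

/-- An environment type for `M`: a type `E` whose elements assign values to finitely many variables,
together with the coordinate functions on `E`, among which are all the constants. -/
class Env (M : Type u) (E : Type u) where
  /-- the coordinate functions -/
  IsVar : (E → M) → Prop
  const : ∀ c, IsVar fun _ => c

instance Env.punit {M : Type u} : Env M PUnit.{u + 1} where
  IsVar f := ∃ c, f = fun _ => c
  const c := ⟨c, rfl⟩

instance Env.prod {M E : Type u} [Env M E] : Env M (E × M) where
  IsVar f := f = Prod.snd ∨ ∃ g : E → M, Env.IsVar g ∧ f = fun e => g e.1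
  const c := Or.inr ⟨fun _ => c, Env.const c, rfl⟩

/-- The type of coordinate functions. -/
abbrev Env.Var (M E : Type u) [Env M E] := {f : E → M // Env.IsVar f}

variable {M : Type u} [Membership M M]

/-- `P` is first-order definable with parameters from `M`. -/
class DefProp (M : Type u) [Membership M M] {E : Type u} [Env M E] (P : E → Prop) : Prop where
  out : ∃ φ : setLanguage.Formula (Env.Var M E), ∀ e, P e ↔ φ.Realize fun f => f.1 e

/-- `f` is a function that is first-order definable with parameters from `M`. -/
class DefFun {E : Type u} [Env M E] (f : E → M) : Prop where
  out : DefProp M fun p : E × M => p.2 = f p.1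

/-- `π` is a projection of environments that forgets the last few variables. -/
class EnvProj (M : Type u) {E E' : Type u} [Env M E] [Env M E'] (π : E → E') : Prop where
  out : ∀ f : E' → M, Env.IsVar f → Env.IsVar fun e => f (π e)

/-- `P` is a definable unary predicate. -/
abbrev DefProp₁ (P : M → Prop) : Prop := DefProp M fun e : PUnit.{u + 1} × M => P e.2
/-- `P` is a definable binary predicate. -/
abbrev DefProp₂ (P : M → M → Prop) : Prop :=
  DefProp M fun e : (PUnit.{u + 1} × M) × M => P e.1.2 e.2
/-- `F` is a definable unary function. -/
abbrev DefFun₁ (F : M → M) : Prop := DefFun fun e : PUnit.{u + 1} × M => F e.2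
/-- `F` is a definable binary function. -/
abbrev DefFun₂ (F : M → M → M) : Prop := DefFun fun e : (PUnit.{u + 1} × M) × M => F e.1.2 e.2

variable {E E' : Type u} [Env M E] [Env M E']

instance EnvProj.id : EnvProj M fun e : E => e := ⟨fun _ h => h⟩

instance EnvProj.fst {π : E → E' × M} [h : EnvProj M π] : EnvProj M fun e => (π e).1 :=
  ⟨fun f hf => h.out (fun e => f e.1) (Or.inr ⟨f, hf, rfl⟩)⟩

theorem DefProp.congr {P Q : E → Prop} [h : DefProp M P] (hPQ : ∀ e, Q e ↔ P e) : DefProp M Q := by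
  obtain ⟨φ, hφ⟩ := h.out
  exact ⟨φ, fun e => (hPQ e).trans (hφ e)⟩

instance DefProp.const (p : Prop) : DefProp M fun _ : E => p := by
  by_cases hp : p
  · exact ⟨⊤, by simp [hp]⟩
  · exact ⟨⊥, by simp [hp]⟩

instance DefProp.imp {P Q : E → Prop} [hP : DefProp M P] [hQ : DefProp M Q] :
    DefProp M fun e => P e → Q e := by
  obtain ⟨φ, hφ⟩ := hP.out
  obtain ⟨ψ, hψ⟩ := hQ.out
  exact ⟨φ.imp ψ, fun e => by rw [Language.Formula.realize_imp, hφ, hψ]⟩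

instance DefProp.not {P : E → Prop} [hP : DefProp M P] : DefProp M fun e => ¬ P e := by
  obtain ⟨φ, hφ⟩ := hP.out
  exact ⟨φ.not, fun e => by rw [Language.Formula.realize_not, hφ]⟩

instance DefProp.and {P Q : E → Prop} [DefProp M P] [DefProp M Q] :
    DefProp M fun e => P e ∧ Q e :=
  DefProp.congr (P := fun e => ¬ (P e → ¬ Q e)) fun e => by tauto

instance DefProp.or {P Q : E → Prop} [DefProp M P] [DefProp M Q] :
    DefProp M fun e => P e ∨ Q e :=
  DefProp.congr (P := fun e => ¬ P e → Q e) fun e => by tauto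

instance DefProp.iff {P Q : E → Prop} [DefProp M P] [DefProp M Q] :
    DefProp M fun e => (P e ↔ Q e) :=
  DefProp.congr (P := fun e => (P e → Q e) ∧ (Q e → P e)) fun e => by tauto

/-- Substitution of coordinate functions for the variables of an environment. -/
theorem DefProp.subst {P : E' → Prop} [h : DefProp M P] (s : E → E')
    (hs : ∀ f : E' → M, Env.IsVar f → Env.IsVar fun e => f (s e)) : DefProp M fun e => P (s e) := by
  obtain ⟨φ, hφ⟩ := h.out
  refine ⟨φ.relabel fun f => ⟨fun e => f.1 (s e), hs f.1 f.2⟩, fun e => ?_⟩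
  rw [Language.Formula.realize_relabel, hφ]
  rfl

instance DefProp.all {P : E → M → Prop} [h : DefProp M fun p : E × M => P p.1 p.2] :
    DefProp M fun e => ∀ x, P e x := by
  classical
  obtain ⟨φ, hφ⟩ := h.out
  -- A coordinate of E × M that factors through E stays free; the remaining one is the last
  -- coordinate, which the quantifier binds.
  let r : Env.Var M (E × M) → Env.Var M E ⊕ Unit := fun f =>
    if hf : ∃ g : E → M, Env.IsVar g ∧ f.1 = fun e => g e.1 then
      Sum.inl ⟨hf.choose, hf.choose_spec.1⟩ else Sum.inr ()
  refine ⟨(φ.relabel r).iAlls Unit, fun e => ?_⟩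
  have key : ∀ (x : M), (fun a => Sum.elim (fun f : Env.Var M E => f.1 e) (fun _ : Unit => x) (r a))
      = fun f : Env.Var M (E × M) => f.1 (e, x) := by
    intro x
    funext f
    by_cases hf : ∃ g : E → M, Env.IsVar g ∧ f.1 = fun e => g e.1
    · simp only [r, hf, dif_pos, Sum.elim_inl]
      exact (congrFun hf.choose_spec.2 (e, x)).symm
    · simp only [r, hf, dif_neg, not_false_eq_true, Sum.elim_inr]
      rcases f.2 with h | h
      · rw [h]
      · exact absurd h hf
  rw [Language.Formula.realize_iAlls]
  constructor
  · intro H i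
    rw [Language.Formula.realize_relabel]
    have := (hφ (e, i ())).1 (H (i ()))
    rw [← key] at this
    exact this
  · intro H x
    have := H fun _ => x
    rw [Language.Formula.realize_relabel] at this
    refine (hφ (e, x)).2 ?_
    rw [← key]
    exact this

instance DefProp.ex {P : E → M → Prop} [h : DefProp M fun p : E × M => P p.1 p.2] :
    DefProp M fun e => ∃ x, P e x :=
  DefProp.congr (P := fun e => ¬ ∀ x, ¬ P e x) fun e => by push Not; rfl

theorem DefProp.mem_var (f g : E → M) (hf : Env.IsVar f) (hg : Env.IsVar g) :
    DefProp M fun e => f e ∈ g e := by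
  let r : setLanguage.Relations 2 := MemSymbol.mem
  refine ⟨r.formula₂ (Language.Term.var ⟨f, hf⟩) (Language.Term.var ⟨g, hg⟩), fun e => ?_⟩
  rw [Language.Formula.realize_rel₂]
  rfl

theorem DefProp.eq_var (f g : E → M) (hf : Env.IsVar f) (hg : Env.IsVar g) :
    DefProp M fun e => f e = g e := by
  refine ⟨Language.Term.equal
    (Language.Term.var ⟨f, hf⟩) (Language.Term.var ⟨g, hg⟩), fun e => ?_⟩
  rw [Language.Formula.realize_equal]
  rfl

theorem DefFun.of_var (f : E → M) (hf : Env.IsVar f) : DefFun f :=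
  ⟨DefProp.eq_var _ _ (Or.inl rfl) (Or.inr ⟨f, hf, rfl⟩)⟩

instance DefFun.const (c : M) : DefFun fun _ : E => c := DefFun.of_var _ (Env.const c)

instance DefFun.snd {π : E → E' × M} [h : EnvProj M π] : DefFun fun e => (π e).2 :=
  DefFun.of_var _ (h.out _ (Or.inl rfl))

theorem DefProp.of_graph (P : E → Prop) {f : E → M} {Q : E × M → Prop} [hf : DefFun f]
    [DefProp M Q] (hPQ : ∀ e, P e ↔ Q (e, f e)) : DefProp M P := by
  have := hf.out
  refine DefProp.congr (P := fun e => ∃ y, y = f e ∧ Q (e, y)) fun e => ?_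
  simp [hPQ]

/-- Substitution of a definable function for the last variable. -/
theorem DefProp.comp {Q : E × M → Prop} [DefProp M Q] (f : E → M) [DefFun f] :
    DefProp M fun e => Q (e, f e) :=
  DefProp.of_graph _ fun _ => Iff.rfl

instance (priority := low) EnvProj.defProp {P : E' → Prop} [DefProp M P] {π : E → E'} [h : EnvProj M π] :
    DefProp M fun e => P (π e) :=
  DefProp.subst π h.out

instance (priority := low) EnvProj.defFun {f : E' → M} [hf : DefFun f] {π : E → E'} [h : EnvProj M π] :
    DefFun fun e => f (π e) := by
  refine ⟨?_⟩
  have := hf.out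
  refine DefProp.subst (P := fun p : E' × M => p.2 = f p.1) (fun p : E × M => (π p.1, p.2)) ?_
  rintro g (rfl | ⟨g, hg, rfl⟩)
  · exact Or.inl rfl
  · exact Or.inr ⟨_, h.out g hg, rfl⟩

/-- Substitution of two definable functions for the last two variables. -/
theorem DefProp.comp₂ (P : M → M → Prop) [h : DefProp₂ P] (f g : E → M) [hf : DefFun f]
    [hg : DefFun g] : DefProp M fun e => P (f e) (g e) := by
  have h1 : DefProp M fun p : (E × M) × M => P p.1.2 p.2 := by
    refine DefProp.subst (P := fun e : (PUnit.{u + 1} × M) × M => P e.1.2 e.2)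
      (fun p : (E × M) × M => ((PUnit.unit, p.1.2), p.2)) ?_
    rintro g (rfl | ⟨g, (rfl | ⟨g, ⟨c, rfl⟩, rfl⟩), rfl⟩)
    · exact Or.inl rfl
    · exact Or.inr ⟨_, Or.inl rfl, rfl⟩
    · exact Env.const c
  have h2 : DefFun fun p : E × M => g p.1 := EnvProj.defFun (π := fun p : E × M => p.1)
  have h3 := DefProp.comp (Q := fun p : (E × M) × M => P p.1.2 p.2) fun p : E × M => g p.1
  exact DefProp.comp (Q := fun p : E × M => P p.2 (g p.1)) f

theorem DefProp.comp₁ (P : M → Prop) [h : DefProp₁ P] (f : E → M) [hf : DefFun f] :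
    DefProp M fun e => P (f e) := by
  have h1 : DefProp M fun p : E × M => P p.2 := by
    refine DefProp.subst (P := fun e : PUnit.{u + 1} × M => P e.2)
      (fun p : E × M => (PUnit.unit, p.2)) ?_
    rintro g (rfl | ⟨g, ⟨c, rfl⟩, rfl⟩)
    · exact Or.inl rfl
    · exact Env.const c
  exact DefProp.comp (Q := fun p : E × M => P p.2) f

instance DefProp.mem {f g : E → M} [DefFun f] [DefFun g] : DefProp M fun e => f e ∈ g e := by
  have : DefProp₂ fun x y : M => x ∈ y :=
    DefProp.mem_var _ _ (Or.inr ⟨_, Or.inl rfl, rfl⟩) (Or.inl rfl)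
  exact DefProp.comp₂ (fun x y => x ∈ y) f g

instance DefProp.eq {f g : E → M} [DefFun f] [DefFun g] : DefProp M fun e => f e = g e := by
  have : DefProp₂ fun x y : M => x = y :=
    DefProp.eq_var _ _ (Or.inr ⟨_, Or.inl rfl, rfl⟩) (Or.inl rfl)
  exact DefProp.comp₂ (fun x y => x = y) f g

instance DefProp.ne {f g : E → M} [DefFun f] [DefFun g] : DefProp M fun e => f e ≠ g e :=
  inferInstanceAs (DefProp M fun e => ¬ (f e = g e))

theorem DefFun.mk' {f : E → M} (Q : E → M → Prop) [DefProp M fun p : E × M => Q p.1 p.2]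
    (h : ∀ e y, y = f e ↔ Q e y) : DefFun f :=
  ⟨DefProp.congr fun p => h p.1 p.2⟩

instance DefFun.comp {F : M → M} [hF : DefFun₁ F] {f : E → M} [DefFun f] :
    DefFun fun e => F (f e) := by
  have := hF.out
  have : DefProp₂ fun x y => y = F x := this
  have : DefFun fun p : E × M => f p.1 := EnvProj.defFun (π := fun p : E × M => p.1)
  exact ⟨DefProp.comp₂ (fun x y => y = F x) (fun p : E × M => f p.1) fun p => p.2⟩

instance DefFun.comp₂ {F : M → M → M} [hF : DefFun₂ F] {f g : E → M} [DefFun f] [DefFun g] :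
    DefFun fun e => F (f e) (g e) := by
  have := hF.out
  have h1 : DefProp M fun p : ((E × M) × M) × M => p.2 = F p.1.1.2 p.1.2 := by
    refine DefProp.subst (P := fun p : ((PUnit.{u + 1} × M) × M) × M => p.2 = F p.1.1.2 p.1.2)
      (fun p : ((E × M) × M) × M => (((PUnit.unit, p.1.1.2), p.1.2), p.2)) ?_
    rintro g (rfl | ⟨g, (rfl | ⟨g, (rfl | ⟨g, ⟨c, rfl⟩, rfl⟩), rfl⟩), rfl⟩)
    · exact Or.inl rfl
    · exact Or.inr ⟨_, Or.inl rfl, rfl⟩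
    · exact Or.inr ⟨_, Or.inr ⟨_, Or.inl rfl, rfl⟩, rfl⟩
    · exact Env.const c
  have hf2 : DefFun fun p : E × M => f p.1 := EnvProj.defFun (π := fun p : E × M => p.1)
  have hg2 : DefFun fun p : E × M => g p.1 := EnvProj.defFun (π := fun p : E × M => p.1)
  have hf3 : DefProp M fun p : (E × M) × M => p.2 = f p.1.1 := hf2.out
  have hg3 : DefFun fun p : (E × M) × M => g p.1.1 := 
    EnvProj.defFun (f := fun p : E × M => g p.1) (π := fun p : (E × M) × M => p.1)
  have hg4 : DefProp M fun p : ((E × M) × M) × M => p.2 = g p.1.1.1 := hg3.out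
  refine ⟨DefProp.congr (P := fun p : E × M => ∃ x, x = f p.1 ∧ ∃ y, y = g p.1 ∧ p.2 = F x y)
    (h := ?_) fun p => by simp⟩
  refine @DefProp.ex M _ _ _ _ (@DefProp.and _ _ _ _ _ _ hf3 ?_)
  refine @DefProp.ex M _ _ _ _ (@DefProp.and _ _ _ _ _ _ hg4 ?_)
  exact DefProp.subst (P := fun p : ((E × M) × M) × M => p.2 = F p.1.1.2 p.1.2)
    (fun p : ((E × M) × M) × M => (((p.1.1.1, p.1.2), p.2), p.1.1.2)) (by
    rintro g (rfl | ⟨g, (rfl | ⟨g, (rfl | ⟨g, hg, rfl⟩), rfl⟩), rfl⟩)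
    · exact Or.inr ⟨_, Or.inr ⟨_, Or.inl rfl, rfl⟩, rfl⟩
    · exact Or.inl rfl
    · exact Or.inr ⟨_, Or.inl rfl, rfl⟩
    · exact Or.inr ⟨_, Or.inr ⟨_, Or.inr ⟨g, hg, rfl⟩, rfl⟩, rfl⟩)

attribute [instance low] DefProp.comp₁ DefProp.comp₂

end Definability

/-! ### The schemes of ZF for definable predicates -/

section Schemes

variable {M : Type u} [Membership M M]

/-- Only finitely many coordinates occur in a formula, and each is the argument or a constant. The
constants become the parameters, which gives the form required by the separation scheme. -/
theorem DefProp₁.exists_formula [Nonempty M] (P : M → Prop) [h : DefProp₁ P] :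
    ∃ (n : ℕ) (φ : setLanguage.Formula (Fin (n + 1))) (p : Fin n → M),
      ∀ x, P x ↔ φ.Realize (Fin.cons x p : Fin (n + 1) → M) := by
  classical
  obtain ⟨φ, hφ⟩ := h.out
  let σ := φ.freeVarFinset
  let eqv := σ.equivFin
  -- The parameter slot of the argument itself is never read, so it gets a default value.
  have hp : ∀ i, ∃ c, (eqv.symm i).1.1 = Prod.snd ∨ (eqv.symm i).1.1 = fun _ => c := by
    intro i
    rcases (eqv.symm i).1.2 with h | ⟨g, ⟨c, rfl⟩, h⟩
    · exact ⟨Classical.arbitrary M, Or.inl h⟩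
    · exact ⟨c, Or.inr h⟩
  choose p hp using hp
  refine ⟨σ.card, Language.BoundedFormula.restrictFreeVar φ
    (fun f : σ => if f.1.1 = Prod.snd then 0 else (eqv f).succ), p, fun x => ?_⟩
  refine (hφ (PUnit.unit, x)).trans
    (Language.BoundedFormula.realize_restrictFreeVar _ fun f => ?_).symm
  by_cases hf : f.1.1 = Prod.snd
  · simp [hf]
  · have := hp (eqv f)
    simp only [Equiv.symm_apply_apply, hf, false_or] at this
    simp only [hf, if_false]
    rw [this]
    rfl

theorem DefProp₂.exists_formula [Nonempty M] (P : M → M → Prop) [h : DefProp₂ P] :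
    ∃ (n : ℕ) (φ : setLanguage.Formula (Fin (n + 2))) (p : Fin n → M),
      ∀ x y, P x y ↔
        φ.Realize (Fin.cons x (Fin.cons y p : Fin (n + 1) → M) : Fin (n + 2) → M) := by
  classical
  obtain ⟨φ, hφ⟩ := h.out
  let σ := φ.freeVarFinset
  let eqv := σ.equivFin
  have hp : ∀ i, ∃ c, (eqv.symm i).1.1 = Prod.snd ∨ (eqv.symm i).1.1 = (fun e => e.1.2) ∨
      (eqv.symm i).1.1 = fun _ => c := by
    intro i
    rcases (eqv.symm i).1.2 with h | ⟨_, rfl | ⟨_, ⟨c, rfl⟩, rfl⟩, h⟩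
    · exact ⟨Classical.arbitrary M, Or.inl h⟩
    · exact ⟨Classical.arbitrary M, Or.inr (Or.inl h)⟩
    · exact ⟨c, Or.inr (Or.inr h)⟩
  choose p hp using hp
  refine ⟨σ.card, Language.BoundedFormula.restrictFreeVar φ
    (fun f : σ => if f.1.1 = Prod.snd then 1 else if f.1.1 = fun e => e.1.2 then 0
      else (eqv f).succ.succ), p, fun x y => ?_⟩
  refine (hφ ((PUnit.unit, x), y)).trans
    (Language.BoundedFormula.realize_restrictFreeVar _ fun f => ?_).symm
  by_cases hf : f.1.1 = Prod.snd
  · simp [hf]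
  · by_cases hf' : f.1.1 = fun e => e.1.2
    · have h0 : ¬ ((fun e : (PUnit.{u + 1} × M) × M => e.1.2) = Prod.snd) := hf' ▸ hf
      simp [hf', h0]
    · have := hp (eqv f)
      simp only [Equiv.symm_apply_apply, hf, hf', false_or] at this
      simp only [hf, hf', if_false]
      rw [this]
      rfl

end Schemes

/-! ### Elementary set theory in a model of ZF -/

/-- `M` is a model of ZF. -/
class ZF (M : Type u) [Membership M M] : Prop where
  models : ModelsZF M

/-! ### Definability of the notions in the statement -/

section Instances

variable {M : Type u} [Membership M M] {E : Type u} [Env M E] {f g h k : E → M}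
  [DefFun f] [DefFun g] [DefFun h] [DefFun k]

instance : DefProp M fun e => IsSubset (f e) (g e) := by unfold IsSubset; infer_instance
instance : DefProp M fun e => IsPair (f e) (g e) (h e) := by unfold IsPair; infer_instance
instance : DefProp M fun e => IsSucc (f e) (g e) := by unfold IsSucc; infer_instance
instance : DefProp M fun e => IsOrdPair (f e) (g e) (h e) := by unfold IsOrdPair; infer_instance
instance : DefProp M fun e => App (f e) (g e) (h e) := by unfold App; infer_instance
instance : DefProp M fun e => IsFunction (f e) := by unfold IsFunction; infer_instance
instance : DefProp M fun e => IsDomain (f e) (g e) := by unfold IsDomain; infer_instance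
instance : DefProp M fun e => IsSeqOn (f e) (g e) := by unfold IsSeqOn; infer_instance
instance : DefProp M fun e => IsMap (f e) (g e) (h e) := by unfold IsMap; infer_instance
instance : DefProp M fun e => IsTransitive (f e) := by unfold IsTransitive; infer_instance
instance : DefProp M fun e => IsOrdinal (f e) := by unfold IsOrdinal; infer_instance
instance : DefProp M fun e => IsLimitOrdinal (f e) := by unfold IsLimitOrdinal; infer_instance
instance : DefProp M fun e => IsCofinalIn (f e) (g e) := by unfold IsCofinalIn; infer_instance
instance : DefProp M fun e => IsClosedIn (f e) (g e) := by unfold IsClosedIn; infer_instance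
instance : DefProp M fun e => IsClubIn (f e) (g e) := by unfold IsClubIn; infer_instance
instance : DefProp M fun e => IsInjection (f e) (g e) (h e) := by
  unfold IsInjection; infer_instance
instance : DefProp M fun e => IsBijection (f e) (g e) (h e) := by
  unfold IsBijection; infer_instance

end Instances

/-! ### Definite descriptions and the basic set operations -/

section Basic

variable {M : Type u} [Membership M M] [hM : ZF M]

instance : Nonempty M := hM.models.infinity.nonempty

theorem ext_mem {x y : M} (h : ∀ z, z ∈ x ↔ z ∈ y) : x = y := hM.models.extensionality x y h

/-- The unique `x` with `P x`, if there is one. -/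
noncomputable def iota (P : M → Prop) : M :=
  open Classical in if h : ∃! x, P x then h.choose else Classical.arbitrary M

theorem iota_spec {P : M → Prop} (h : ∃! x, P x) : P (iota P) := by
  rw [iota, dif_pos h]; exact h.choose_spec.1

theorem iota_eq {P : M → Prop} {x : M} (hx : P x) (h : ∀ y, P y → y = x) : iota P = x :=
  h _ (iota_spec ⟨x, hx, h⟩)

instance {E : Type u} [Env M E] {P : E → M → Prop} [DefProp M fun p : E × M => P p.1 p.2] :
    DefFun fun e => iota (P e) := by
  have : DefProp M fun p : (E × M) × M => P p.1.1 p.2 :=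
    DefProp.subst (P := fun p : E × M => P p.1 p.2) (fun p : (E × M) × M => (p.1.1, p.2)) (by
      rintro g (rfl | ⟨g, hg, rfl⟩)
      · exact Or.inl rfl
      · exact Or.inr ⟨_, Or.inr ⟨g, hg, rfl⟩, rfl⟩)
  have : DefProp M fun p : ((E × M) × M) × M => P p.1.1.1 p.2 :=
    DefProp.subst (P := fun p : E × M => P p.1 p.2) (fun p : ((E × M) × M) × M => (p.1.1.1, p.2)) (by
      rintro g (rfl | ⟨g, hg, rfl⟩)
      · exact Or.inl rfl
      · exact Or.inr ⟨_, Or.inr ⟨_, Or.inr ⟨g, hg, rfl⟩, rfl⟩, rfl⟩)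
  -- The default value is a fixed element of M, hence a parameter, so the graph stays definable even
  -- where the description fails.
  refine DefFun.mk' (fun e y => ((∃ x, P e x ∧ ∀ z, P e z → z = x) ∧ P e y) ∨
    (¬ (∃ x, P e x ∧ ∀ z, P e z → z = x) ∧ y = Classical.arbitrary M)) fun e y => ?_
  by_cases h : ∃! x, P e x
  · have h' : ∃ x, P e x ∧ ∀ z, P e z → z = x := h
    simp only [h', true_and, not_true_eq_false, false_and, or_false]
    exact ⟨fun hy => hy ▸ iota_spec h, fun hy => h.unique hy (iota_spec h)⟩
  · have h' : ¬ ∃ x, P e x ∧ ∀ z, P e z → z = x := h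
    simp only [h', false_and, not_false_eq_true, true_and, false_or]
    rw [iota, dif_neg h]

/-- The set of all `x` with `P x`, if it exists. -/
noncomputable def mkSet (P : M → Prop) : M := iota fun b => ∀ x, x ∈ b ↔ P x

theorem mem_mkSet {P : M → Prop} (h : ∃ b : M, ∀ x, x ∈ b ↔ P x) {x : M} :
    x ∈ mkSet P ↔ P x := by
  obtain ⟨b, hb⟩ := h
  exact iota_spec (P := fun b => ∀ x, x ∈ b ↔ P x)
    ⟨b, hb, fun c hc => ext_mem fun z => (hc z).trans (hb z).symm⟩ x

variable {E : Type u} [Env M E]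

instance {P : E → M → Prop} [DefProp M fun p : E × M => P p.1 p.2] :
    DefFun fun e => mkSet (P e) := by
  have : DefProp M fun p : (E × M) × M => P p.1.1 p.2 :=
    DefProp.subst (P := fun p : E × M => P p.1 p.2) (fun p : (E × M) × M => (p.1.1, p.2)) (by
      rintro g (rfl | ⟨g, hg, rfl⟩)
      · exact Or.inl rfl
      · exact Or.inr ⟨_, Or.inr ⟨g, hg, rfl⟩, rfl⟩)
  unfold mkSet; infer_instance

/-- `{x ∈ a | P x}` -/
noncomputable def sep (a : M) (P : M → Prop) : M := mkSet fun x => x ∈ a ∧ P x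

theorem mem_sep {a : M} {P : M → Prop} [DefProp₁ P] {x : M} : x ∈ sep a P ↔ x ∈ a ∧ P x := by
  refine mem_mkSet ?_
  obtain ⟨n, φ, p, h⟩ := DefProp₁.exists_formula P
  obtain ⟨b, hb⟩ := hM.models.separation n φ p a
  exact ⟨b, fun x => by rw [hb, h]⟩

/-- `{F x | x ∈ a}` -/
noncomputable def img (F : M → M) (a : M) : M := mkSet fun y => ∃ x, x ∈ a ∧ y = F x

theorem mem_img {F : M → M} [DefFun₁ F] {a y : M} : y ∈ img F a ↔ ∃ x, x ∈ a ∧ y = F x := by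
  refine mem_mkSet ?_
  obtain ⟨n, φ, p, h⟩ := DefProp₂.exists_formula fun x y => y = F x
  obtain ⟨b, hb⟩ := hM.models.replacement n φ p a fun x _ y z hy hz => by
    rw [← h] at hy hz; rw [hy, hz]
  exact ⟨b, fun x => by simp only [hb, h]⟩

variable (M) in
/-- The empty set. -/
noncomputable def emp : M := sep (Classical.arbitrary M) fun _ => False

@[simp] theorem notMem_emp {x : M} : x ∉ emp M := fun h => (mem_sep.1 h).2

theorem eq_emp {x : M} (h : ∀ y, y ∉ x) : x = emp M := ext_mem fun y => by simp [h]

/-- `{x, y}` -/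
noncomputable def upair (x y : M) : M := mkSet fun z => z = x ∨ z = y

@[simp] theorem mem_upair {x y z : M} : z ∈ upair x y ↔ z = x ∨ z = y :=
  mem_mkSet (hM.models.pairing x y)

/-- `⋃ x` -/
noncomputable def sUnion (x : M) : M := mkSet fun z => ∃ y, y ∈ x ∧ z ∈ y

@[simp] theorem mem_sUnion {x z : M} : z ∈ sUnion x ↔ ∃ y, y ∈ x ∧ z ∈ y :=
  mem_mkSet (hM.models.union x)

/-- The powerset of `x`. -/
noncomputable def pow (x : M) : M := mkSet fun z => IsSubset z x

@[simp] theorem mem_pow {x z : M} : z ∈ pow x ↔ IsSubset z x := mem_mkSet (hM.models.powerset x)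

/-- `x ∪ y` -/
noncomputable def union (x y : M) : M := mkSet fun z => z ∈ x ∨ z ∈ y

@[simp] theorem mem_union {x y z : M} : z ∈ union x y ↔ z ∈ x ∨ z ∈ y :=
  mem_mkSet ⟨sUnion (upair x y), fun z => by simp⟩

/-- `x ∪ {x}` -/
noncomputable def succ (x : M) : M := union x (upair x x)

@[simp] theorem mem_succ {x z : M} : z ∈ succ x ↔ z ∈ x ∨ z = x := by simp [succ]

/-- The Kuratowski pair. -/
noncomputable def opair (x y : M) : M := upair (upair x x) (upair x y)

variable {f g h : E → M} [DefFun f] [DefFun g] [DefFun h]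

instance {P : E → M → Prop} [DefProp M fun p : E × M => P p.1 p.2] :
    DefFun fun e => sep (f e) (P e) := by
  unfold sep; infer_instance

instance {F : E → M → M} [DefFun fun p : E × M => F p.1 p.2] :
    DefFun fun e => img (F e) (f e) := by
  have : DefFun fun p : (E × M) × M => F p.1.1 p.2 := by
    have := DefFun.out (f := fun p : E × M => F p.1 p.2)
    refine ⟨DefProp.subst (P := fun p : (E × M) × M => p.2 = F p.1.1 p.1.2)
      (fun p : ((E × M) × M) × M => ((p.1.1.1, p.1.2), p.2)) ?_⟩
    rintro g (rfl | ⟨g, (rfl | ⟨g, hg, rfl⟩), rfl⟩)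
    · exact Or.inl rfl
    · exact Or.inr ⟨_, Or.inl rfl, rfl⟩
    · exact Or.inr ⟨_, Or.inr ⟨_, Or.inr ⟨g, hg, rfl⟩, rfl⟩, rfl⟩
  have : DefFun fun p : ((E × M) × M) × M => F p.1.1.1 p.2 := by
    have := DefFun.out (f := fun p : E × M => F p.1 p.2)
    refine ⟨DefProp.subst (P := fun p : (E × M) × M => p.2 = F p.1.1 p.1.2)
      (fun p : (((E × M) × M) × M) × M => ((p.1.1.1.1, p.1.2), p.2)) ?_⟩
    rintro g (rfl | ⟨g, (rfl | ⟨g, hg, rfl⟩), rfl⟩)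
    · exact Or.inl rfl
    · exact Or.inr ⟨_, Or.inl rfl, rfl⟩
    · exact Or.inr ⟨_, Or.inr ⟨_, Or.inr ⟨_, Or.inr ⟨g, hg, rfl⟩, rfl⟩, rfl⟩, rfl⟩
  unfold img; infer_instance

instance : DefFun fun e => upair (f e) (g e) := by unfold upair; infer_instance
instance : DefFun fun e => sUnion (f e) := by unfold sUnion; infer_instance
instance : DefFun fun e => pow (f e) := by unfold pow; infer_instance
instance : DefFun fun e => union (f e) (g e) := by unfold union; infer_instance
instance : DefFun fun e => succ (f e) := by unfold succ; infer_instance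
instance : DefFun fun e => opair (f e) (g e) := by unfold opair; infer_instance

end Basic

variable {M : Type u} [Membership M M]

theorem IsOrdinal.trans {α β γ : M} (hα : IsOrdinal α) (h1 : γ ∈ β) (h2 : β ∈ α) : γ ∈ α :=
  hα.1 β h2 γ h1

theorem IsOrdinal.subset {α β : M} (hα : IsOrdinal α) (h : β ∈ α) : IsSubset β α := hα.1 β h

variable [hM : ZF M]

/-! ### Functions -/

section Functions

theorem isPair_iff {x y p : M} : IsPair x y p ↔ p = upair x y :=
  ⟨fun h => ext_mem fun z => by rw [h z, mem_upair], fun h z => by rw [h, mem_upair]⟩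

theorem upair_eq_upair {x y x' y' : M} (h : upair x y = upair x' y') :
    (x = x' ∧ y = y') ∨ (x = y' ∧ y = x') := by
  have h1 : ∀ z, (z = x ∨ z = y) ↔ (z = x' ∨ z = y') := fun z => by
    rw [← mem_upair, h, mem_upair]
  have hx := h1 x
  have hy := h1 y
  have hx' := h1 x'
  have hy' := h1 y'
  clear h1 h
  grind

theorem isOrdPair_iff {x y p : M} : IsOrdPair x y p ↔ p = opair x y := by
  simp [IsOrdPair, isPair_iff, opair]

theorem opair_inj {x y x' y' : M} : opair x y = opair x' y' ↔ x = x' ∧ y = y' := by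
  refine ⟨fun h => ?_, fun h => by rw [h.1, h.2]⟩
  rcases upair_eq_upair h with ⟨h1, h2⟩ | ⟨h1, h2⟩ <;>
  rcases upair_eq_upair h1 with ⟨h3, h4⟩ | ⟨h3, h4⟩ <;>
  rcases upair_eq_upair h2 with ⟨h5, h6⟩ | ⟨h5, h6⟩ <;> grind

theorem app_iff {f x y : M} : App f x y ↔ opair x y ∈ f := by
  simp [App, isOrdPair_iff]

/-- The value of the function `f` at `x`. -/
noncomputable def ap (f x : M) : M := iota fun y => App f x y

/-- The function `x ↦ F x` with domain `a`. -/
noncomputable def lam (a : M) (F : M → M) : M := img (fun x => opair x (F x)) a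

instance {E : Type u} [Env M E] {f g : E → M} [DefFun f] [DefFun g] :
    DefFun fun e => ap (f e) (g e) := by
  unfold ap; infer_instance

instance {E : Type u} [Env M E] {f : E → M} {F : E → M → M} [DefFun f]
    [DefFun fun p : E × M => F p.1 p.2] : DefFun fun e => lam (f e) (F e) := by
  unfold lam; infer_instance

theorem app_lam {a x y : M} {F : M → M} [DefFun₁ F] : App (lam a F) x y ↔ x ∈ a ∧ y = F x := by
  rw [app_iff, lam, mem_img]
  simp only [opair_inj]
  grind

theorem isSeqOn_lam {a : M} {F : M → M} [DefFun₁ F] : IsSeqOn (lam a F) a := by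
  refine ⟨⟨fun p hp => ?_, fun x y z h1 h2 => ?_⟩, fun x => ?_⟩
  · rw [lam, mem_img] at hp
    obtain ⟨x, _, hx⟩ := hp
    exact ⟨x, F x, isOrdPair_iff.2 hx⟩
  · rw [app_lam] at h1 h2
    rw [h1.2, h2.2]
  · simp [app_lam]

theorem IsFunction.ap_eq {f x y : M} (hf : IsFunction f) (h : App f x y) : ap f x = y :=
  iota_eq h fun z hz => hf.2 x z y hz h

theorem IsSeqOn.app_ap {f a x : M} (hf : IsSeqOn f a) (hx : x ∈ a) : App f x (ap f x) := by
  obtain ⟨y, hy⟩ := (hf.2 x).1 hx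
  rwa [hf.1.ap_eq hy]

theorem IsSeqOn.app_iff {f a x y : M} (hf : IsSeqOn f a) : App f x y ↔ x ∈ a ∧ y = ap f x :=
  ⟨fun h => ⟨(hf.2 x).2 ⟨y, h⟩, (hf.1.ap_eq h).symm⟩, fun h => h.2 ▸ hf.app_ap h.1⟩

theorem ap_lam {a x : M} {F : M → M} [DefFun₁ F] (hx : x ∈ a) : ap (lam a F) x = F x :=
  isSeqOn_lam.1.ap_eq (app_lam.2 ⟨hx, rfl⟩)

theorem IsSeqOn.mem_iff {f a p : M} (hf : IsSeqOn f a) :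
    p ∈ f ↔ ∃ x, x ∈ a ∧ p = opair x (ap f x) := by
  constructor
  · intro hp
    obtain ⟨x, y, hxy⟩ := hf.1.1 p hp
    rw [isOrdPair_iff] at hxy
    have : App f x y := ZFModel.app_iff.2 (hxy ▸ hp)
    rw [hf.app_iff] at this
    exact ⟨x, this.1, by rw [hxy, this.2]⟩
  · rintro ⟨x, hx, rfl⟩
    exact ZFModel.app_iff.1 (hf.app_ap hx)

theorem IsSeqOn.eq_lam {f a : M} (hf : IsSeqOn f a) : f = lam a (ap f) :=
  ext_mem fun p => by rw [hf.mem_iff, lam, mem_img]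

theorem lam_congr {a : M} {F G : M → M} [DefFun₁ F] [DefFun₁ G] (h : ∀ x ∈ a, F x = G x) :
    lam a F = lam a G := by
  refine ext_mem fun p => ?_
  rw [lam, lam, mem_img, mem_img]
  exact exists_congr fun x => and_congr_right fun hx => by rw [h x hx]

theorem IsSeqOn.isRestriction_iff {f a b g : M} (hf : IsSeqOn f a) (hb : IsSubset b a) :
    IsRestriction f b g ↔ g = lam b (ap f) := by
  have h : ∀ p, (p ∈ f ∧ ∃ x ∈ b, ∃ y, IsOrdPair x y p) ↔ p ∈ lam b (ap f) := by
    intro p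
    rw [hf.mem_iff, lam, mem_img]
    simp only [isOrdPair_iff]
    constructor
    · rintro ⟨⟨x, hx, rfl⟩, y, hy, z, hz⟩
      exact ⟨x, (opair_inj.1 hz).1 ▸ hy, rfl⟩
    · rintro ⟨x, hx, rfl⟩
      exact ⟨⟨x, hb x hx, rfl⟩, x, hx, _, rfl⟩
  constructor
  · intro hg
    exact ext_mem fun p => (hg p).trans (h p)
  · rintro rfl p
    exact (h p).symm

theorem lam_subset {a b : M} {F G : M → M} [DefFun₁ F] [DefFun₁ G] (hab : IsSubset a b)
    (h : ∀ x ∈ a, F x = G x) : IsSubset (lam a F) (lam b G) := by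
  intro p hp
  rw [lam, mem_img] at hp ⊢
  obtain ⟨x, hx, rfl⟩ := hp
  exact ⟨x, hab x hx, by rw [h x hx]⟩

end Functions

/-! ### Ordinals -/

section Ordinals

theorem mem_irrefl {x : M} : x ∉ x := by
  intro h
  obtain ⟨y, hy, hy'⟩ := hM.models.foundation (upair x x) ⟨x, by simp⟩
  simp only [mem_upair, or_self] at hy hy'
  exact hy' x (hy ▸ h) rfl

theorem mem_asymm {x y : M} (h : x ∈ y) : y ∉ x := by
  intro h'
  obtain ⟨z, hz, hz'⟩ := hM.models.foundation (upair x y) ⟨x, by simp⟩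
  simp only [mem_upair] at hz hz'
  rcases hz with rfl | rfl
  · exact hz' y h' (Or.inr rfl)
  · exact hz' x h (Or.inl rfl)

theorem IsOrdinal.mem {α β : M} (hα : IsOrdinal α) (h : β ∈ α) : IsOrdinal β :=
  ⟨hα.2 β h, fun γ hγ => hα.2 γ (hα.trans hγ h)⟩

/-- Foundation gives an ∈-minimal element of the set of counterexamples in α ∪ {α}. Definability of
P is what makes this a set; seen from outside, M may be ill-founded. -/
theorem ord_induction (P : M → Prop) [DefProp₁ P]
    (h : ∀ α, IsOrdinal α → (∀ β ∈ α, P β) → P α) {α : M} (hα : IsOrdinal α) : P α := by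
  by_contra hP
  obtain ⟨y, hy, hy'⟩ := hM.models.foundation (sep (succ α) fun x => ¬ P x)
    ⟨α, mem_sep.2 ⟨by simp, hP⟩⟩
  rw [mem_sep, mem_succ] at hy
  have hyo : IsOrdinal y := by
    rcases hy.1 with h | rfl
    · exact hα.mem h
    · exact hα
  refine hy.2 (h y hyo fun β hβ => ?_)
  by_contra hPβ
  refine hy' β hβ (mem_sep.2 ⟨?_, hPβ⟩)
  rw [mem_succ]
  rcases hy.1 with h | rfl
  · exact Or.inl (hα.trans hβ h)
  · exact Or.inl hβ

theorem ord_trichotomy {α β : M} (hα : IsOrdinal α) (hβ : IsOrdinal β) :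
    α ∈ β ∨ α = β ∨ β ∈ α := by
  refine ord_induction (fun α => ∀ β, IsOrdinal β → α ∈ β ∨ α = β ∨ β ∈ α) ?_ hα β hβ
  intro α hα ihα β hβ
  refine ord_induction (fun β => α ∈ β ∨ α = β ∨ β ∈ α) ?_ hβ
  intro β hβ ihβ
  by_contra! hcon
  refine hcon.2.1 (ext_mem fun z => ⟨fun hz => ?_, fun hz => ?_⟩)
  · rcases ihα z hz β hβ with h | rfl | h
    · exact h
    · exact absurd hz hcon.2.2
    · exact absurd (hα.trans h hz) hcon.2.2
  · rcases ihβ z hz with h | rfl | h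
    · exact absurd (hβ.trans h hz) hcon.1
    · exact absurd hz hcon.1
    · exact h

theorem ord_notMem {α β : M} (hα : IsOrdinal α) (hβ : IsOrdinal β) :
    α ∉ β ↔ β ∈ α ∨ β = α := by
  constructor
  · intro h
    rcases ord_trichotomy hα hβ with h' | h' | h'
    · exact absurd h' h
    · exact Or.inr h'.symm
    · exact Or.inl h'
  · rintro (h | rfl)
    · exact mem_asymm h
    · exact mem_irrefl

theorem ord_subset_iff {α β : M} (hα : IsOrdinal α) (hβ : IsOrdinal β) :
    IsSubset α β ↔ α ∈ β ∨ α = β := by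
  constructor
  · intro h
    rcases ord_trichotomy hα hβ with h' | h' | h'
    · exact Or.inl h'
    · exact Or.inr h'
    · exact absurd (h _ h') mem_irrefl
  · rintro (h | rfl)
    · exact hβ.subset h
    · exact fun _ h => h

theorem IsOrdinal.succ {α : M} (hα : IsOrdinal α) : IsOrdinal (succ α) := by
  constructor
  · intro β hβ γ hγ
    rw [mem_succ] at *
    rcases hβ with h | rfl
    · exact Or.inl (hα.trans hγ h)
    · exact Or.inl hγ
  · intro β hβ
    rw [mem_succ] at hβ
    rcases hβ with h | rfl
    · exact hα.2 β h
    · exact hα.1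

theorem isOrdinal_emp : IsOrdinal (emp M) :=
  ⟨fun _ hy => absurd hy notMem_emp, fun _ hy => absurd hy notMem_emp⟩

theorem isOrdinal_sUnion {a : M} (ha : ∀ x ∈ a, IsOrdinal x) : IsOrdinal (sUnion a) := by
  constructor
  · intro β hβ γ hγ
    rw [mem_sUnion] at *
    obtain ⟨y, hy, hβ⟩ := hβ
    exact ⟨y, hy, (ha y hy).trans hγ hβ⟩
  · intro β hβ
    rw [mem_sUnion] at *
    obtain ⟨y, hy, hβ⟩ := hβ
    exact (ha y hy).2 β hβ

/-- Burali-Forti: the successor of the supremum of the ordinals in `a` is not in `a`. It makes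
transfinite recursions stop. -/
theorem exists_ord_notMem (a : M) : ∃ α, IsOrdinal α ∧ α ∉ a := by
  have h : ∀ x ∈ sep a fun x => IsOrdinal x, IsOrdinal x := fun x hx => (mem_sep.1 hx).2
  refine ⟨succ (sUnion (sep a fun x => IsOrdinal x)), (isOrdinal_sUnion h).succ, fun hs => ?_⟩
  have h1 : succ (sUnion (sep a fun x => IsOrdinal x)) ∈ sep a fun x => IsOrdinal x :=
    mem_sep.2 ⟨hs, (isOrdinal_sUnion h).succ⟩
  exact mem_irrefl (mem_sUnion.2 ⟨_, h1, mem_succ.2 (Or.inr rfl)⟩)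

/-- `α` is the least ordinal with `P α`. -/
def IsLeast (P : M → Prop) (α : M) : Prop := IsOrdinal α ∧ P α ∧ ∀ β ∈ α, ¬ P β

/-- The least ordinal `α` with `P α`. -/
noncomputable def least (P : M → Prop) : M := iota fun x => IsLeast P x

instance {E : Type u} [Env M E] {P : E → M → Prop} [DefProp M fun p : E × M => P p.1 p.2] :
    DefFun fun e => least (P e) := by
  have : DefProp M fun p : (E × M) × M => P p.1.1 p.2 :=
    DefProp.subst (P := fun p : E × M => P p.1 p.2) (fun p : (E × M) × M => (p.1.1, p.2)) (by
      rintro g (rfl | ⟨g, hg, rfl⟩)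
      · exact Or.inl rfl
      · exact Or.inr ⟨_, Or.inr ⟨g, hg, rfl⟩, rfl⟩)
  unfold least IsLeast; infer_instance

/-- A definable selection from nonempty classes of ordinals, which replaces choice in most of the
argument. -/
theorem least_spec {P : M → Prop} [DefProp₁ P] {α : M} (hα : IsOrdinal α) (h : P α) :
    IsLeast P (least P) := by
  have hex : ∃ β, IsLeast P β := by
    by_contra! hcon
    refine ord_induction (fun α => ¬ P α) (fun β hβ ih hPβ => hcon β ⟨hβ, hPβ, ih⟩) hα h
  obtain ⟨β, hβ⟩ := hex
  refine iota_spec ⟨β, hβ, fun γ hγ => ?_⟩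
  rcases ord_trichotomy hγ.1 hβ.1 with h | h | h
  · exact absurd hγ.2.1 (hβ.2.2 γ h)
  · exact h
  · exact absurd hβ.2.1 (hγ.2.2 β h)

theorem IsLeast.le {P : M → Prop} {α β : M} (h : IsLeast P α) (hβ : IsOrdinal β) (hP : P β) :
    α ∈ β ∨ α = β :=
  (ord_notMem hβ h.1).1 fun h' => h.2.2 β h' hP

theorem IsLimitOrdinal.succ_mem {α β : M} (hα : IsLimitOrdinal α) (hβ : β ∈ α) : succ β ∈ α := by
  obtain ⟨γ, hγ, hβγ⟩ := hα.2.2 β hβ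
  rcases ord_trichotomy (hα.1.mem hβ).succ hα.1 with h | h | h
  · exact h
  · rw [← h, mem_succ] at hγ
    rcases hγ with h' | rfl
    · exact absurd h' (mem_asymm hβγ)
    · exact absurd hβγ mem_irrefl
  · rw [mem_succ] at h
    rcases h with h | rfl
    · exact absurd h (mem_asymm hβ)
    · exact absurd hβ mem_irrefl

theorem exists_isOmega {θ : M} (hθ : IsLimitOrdinal θ) : ∃ w, IsOmega w ∧ (w ∈ θ ∨ w = θ) := by
  have := least_spec (P := fun x => IsLimitOrdinal x) hθ.1 hθ
  exact ⟨_, ⟨this.2.1, this.2.2⟩, this.le hθ.1 hθ⟩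

/-- Induction on `ω`. -/
theorem omega_induction {w : M} (hw : IsOmega w) (P : M → Prop) [DefProp₁ P] (h0 : P (emp M))
    (hs : ∀ n ∈ w, P n → P (succ n)) {n : M} (hn : n ∈ w) : P n := by
  refine ord_induction (fun n => n ∈ w → P n) ?_ (hw.1.1.mem hn) hn
  intro n hno ih hn
  by_cases hlim : ∃ m ∈ n, succ m = n
  · obtain ⟨m, hm, rfl⟩ := hlim
    have := hw.1.1.trans hm hn
    exact hs m this (ih m hm this)
  by_cases h0' : ∃ m, m ∈ n
  · refine absurd ⟨hno, h0', fun m hm => ?_⟩ (hw.2 n hn)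
    refine ⟨succ m, ?_, by simp⟩
    rcases ord_trichotomy (hno.mem hm).succ hno with h | h | h
    · exact h
    · exact absurd ⟨m, hm, h⟩ hlim
    · rw [mem_succ] at h
      rcases h with h | rfl
      · exact absurd h (mem_asymm hm)
      · exact absurd hm mem_irrefl
  · push Not at h0'
    rwa [eq_emp h0']

end Ordinals

/-! ### Transfinite recursion -/

section Recursion

theorem img_congr {F G : M → M} [DefFun₁ F] [DefFun₁ G] {a : M} (h : ∀ x ∈ a, F x = G x) :
    img F a = img G a := by
  refine ext_mem fun y => ?_
  rw [mem_img, mem_img]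
  exact exists_congr fun x => and_congr_right fun hx => by rw [h x hx]

/-- `f` is the restriction to `α` of the function defined by recursion from `H`. -/
def Approx (H : M → M) (f α : M) : Prop := IsSeqOn f α ∧ ∀ β, β ∈ α → ap f β = H (img (ap f) β)

/-- The function on the ordinals defined by the recursion `F α = H {F β | β < α}`. -/
noncomputable def ordRec (H : M → M) (α : M) : M :=
  iota fun y => ∃ f, Approx H f α ∧ y = H (img (ap f) α)

variable (H : M → M) [DefFun₁ H]

instance {E : Type u} [Env M E] {f g : E → M} [DefFun f] [DefFun g] :
    DefProp M fun e => Approx H (f e) (g e) := by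
  unfold Approx; infer_instance

instance : DefFun₁ (ordRec H) := by unfold ordRec; infer_instance

variable {H}

theorem Approx.restrict {f α β : M} (h : Approx H f α) (hα : IsOrdinal α) (hβ : β ∈ α) :
    Approx H (lam β (ap f)) β := by
  refine ⟨isSeqOn_lam, fun γ hγ => ?_⟩
  rw [ap_lam hγ, h.2 γ (hα.trans hγ hβ)]
  refine congrArg H (img_congr fun x hx => (ap_lam ?_).symm)
  exact (hα.mem hβ).trans hx hγ

theorem Approx.unique {f g α : M} (hf : Approx H f α) (hg : Approx H g α) (hα : IsOrdinal α) :
    f = g := by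
  have : ∀ β, IsOrdinal β → β ∈ α → ap f β = ap g β := by
    intro β hβ
    refine ord_induction (fun β => β ∈ α → ap f β = ap g β) ?_ hβ
    intro γ hγo ih hγ
    rw [hf.2 γ hγ, hg.2 γ hγ]
    exact congrArg H (img_congr fun x hx => ih x hx (hα.trans hx hγ))
  rw [hf.1.eq_lam, hg.1.eq_lam]
  exact lam_congr fun x hx => this x (hα.mem hx) hx

theorem Approx.ordRec_eq {f α : M} (hf : Approx H f α) (hα : IsOrdinal α) :
    ordRec H α = H (img (ap f) α) := by
  refine iota_eq ⟨f, hf, rfl⟩ ?_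
  rintro _ ⟨g, hg, rfl⟩
  rw [hf.unique hg hα]

theorem Approx.ap_eq {f α β : M} (hf : Approx H f α) (hα : IsOrdinal α) (hβ : β ∈ α) :
    ap f β = ordRec H β := by
  rw [(hf.restrict hα hβ).ordRec_eq (hα.mem hβ), hf.2 β hβ]
  exact congrArg H (img_congr fun x hx => (ap_lam hx).symm)

variable (H) in
-- Approximations are unique, so those below α agree and together form one on α.
theorem approx_lam {α : M} (hα : IsOrdinal α) : Approx H (lam α (ordRec H)) α := by
  refine ord_induction (fun α => Approx H (lam α (ordRec H)) α) ?_ hα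
  intro α hα ih
  refine ⟨isSeqOn_lam, fun β hβ => ?_⟩
  rw [ap_lam hβ, (ih β hβ).ordRec_eq (hα.mem hβ)]
  refine congrArg H (img_congr fun x hx => ?_)
  rw [ap_lam hx, ap_lam (hα.trans hx hβ)]

variable (H) in
theorem ordRec_eq {α : M} (hα : IsOrdinal α) : ordRec H α = H (img (ordRec H) α) := by
  rw [(approx_lam H hα).ordRec_eq hα]
  exact congrArg H (img_congr fun x hx => ap_lam hx)

end Recursion

/-! ### Enumerations, injections and order types -/

section Enumeration

/-- A set with a definable choice of an element from each of its nonempty subsets is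
enumerated by an ordinal. -/
theorem exists_enumeration (A : M) (p : M → M) [DefFun₁ p]
    (hp : ∀ B, IsSubset B A → (∃ x, x ∈ B) → p B ∈ B) :
    ∃ (τ : M) (F : M → M), IsOrdinal τ ∧ DefFun₁ F ∧ (∀ i ∈ τ, F i ∈ A) ∧
      (∀ i ∈ τ, ∃ B, p B = F i ∧ F i ∈ B ∧ ∀ x, x ∈ B ↔ x ∈ A ∧ ∀ j ∈ i, x ≠ F j) ∧
      (∀ x ∈ A, ∃ i ∈ τ, F i = x) := by
  let F := ordRec fun I => p (sep A fun x => x ∉ I)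
  have hF : DefFun₁ F := inferInstanceAs (DefFun₁ (ordRec fun I => p (sep A fun x => x ∉ I)))
  have hFe : ∀ i, IsOrdinal i → F i = p (sep A fun x => x ∉ img F i) :=
    fun i hi => ordRec_eq (fun I => p (sep A fun x => x ∉ I)) hi
  have hmem : ∀ i, IsOrdinal i → ¬ (∀ x ∈ A, x ∈ img F i) →
      F i ∈ sep A fun x => x ∉ img F i := by
    intro i hi h
    push Not at h
    obtain ⟨x, hx, hx'⟩ := h
    rw [hFe i hi]
    exact hp _ (fun z hz => (mem_sep.1 hz).1) ⟨x, mem_sep.2 ⟨hx, hx'⟩⟩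
  have hinj : ∀ i j, IsOrdinal j → ¬ (∀ x ∈ A, x ∈ img F j) → i ∈ j → F i ≠ F j := by
    intro i j hj h hij heq
    exact (mem_sep.1 (hmem j hj h)).2 (mem_img.2 ⟨i, hij, heq.symm⟩)
  -- Otherwise `F` would inject all ordinals into `A`, and replacement along its inverse would
  -- collect them into a set.
  obtain ⟨α, hα, hα'⟩ : ∃ α, IsOrdinal α ∧ ∀ x ∈ A, x ∈ img F α := by
    by_contra! hcon
    have hcon' : ∀ α, IsOrdinal α → ¬ ∀ x ∈ A, x ∈ img F α := by
      intro α hα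
      push Not
      exact hcon α hα
    obtain ⟨α, hα, hα'⟩ := exists_ord_notMem (img (fun x => iota fun i => IsOrdinal i ∧ F i = x) A)
    refine hα' (mem_img.2 ⟨F α, (mem_sep.1 (hmem α hα (hcon' α hα))).1, ?_⟩)
    refine (iota_eq (P := fun i => IsOrdinal i ∧ F i = F α) ⟨hα, rfl⟩ ?_).symm
    rintro β ⟨hβ, h⟩
    rcases ord_trichotomy hβ hα with h' | h' | h'
    · exact absurd h (hinj β α hα (hcon' α hα) h')
    · exact h'
    · exact absurd h.symm (hinj α β hβ (hcon' β hβ) h')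
  have hτ := least_spec (P := fun α => ∀ x ∈ A, x ∈ img F α) hα hα'
  refine ⟨_, F, hτ.1, hF, fun i hi => ?_, fun i hi => ?_, fun x hx => ?_⟩
  · exact (mem_sep.1 (hmem i (hτ.1.mem hi) (hτ.2.2 i hi))).1
  · refine ⟨_, (hFe i (hτ.1.mem hi)).symm, hmem i (hτ.1.mem hi) (hτ.2.2 i hi), fun x => ?_⟩
    rw [mem_sep, mem_img]
    push Not
    rfl
  · obtain ⟨i, hi, hx⟩ := mem_img.1 (hτ.2.1 x hx)
    exact ⟨i, hi, hx.symm⟩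

/-- `F` is the increasing enumeration of `A` in order type `τ`. -/
structure IsEnum (F : M → M) (τ A : M) : Prop where
  mem : ∀ i ∈ τ, F i ∈ A
  lt : ∀ i ∈ τ, ∀ j ∈ τ, i ∈ j → F i ∈ F j
  surj : ∀ x ∈ A, ∃ i ∈ τ, F i = x

/-- There is a definable injection from `a` into `b`. -/
def Inj (a b : M) : Prop :=
  ∃ F : M → M, DefFun₁ F ∧ (∀ x ∈ a, F x ∈ b) ∧ ∀ x ∈ a, ∀ y ∈ a, F x = F y → x = y

theorem Inj.trans {a b c : M} (h1 : Inj a b) (h2 : Inj b c) : Inj a c := by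
  obtain ⟨F, hF, hFb, hFi⟩ := h1
  obtain ⟨G, hG, hGc, hGi⟩ := h2
  exact ⟨fun x => G (F x), inferInstance, fun x hx => hGc _ (hFb x hx),
    fun x hx y hy h => hFi x hx y hy (hGi _ (hFb x hx) _ (hFb y hy) h)⟩

theorem Inj.of_subset {a b : M} (h : IsSubset a b) : Inj a b :=
  ⟨fun x => x, inferInstance, h, fun _ _ _ _ h => h⟩

theorem Inj.of_surj {a b : M} (G : M → M) [DefFun₁ G] (ha : ∀ i ∈ a, IsOrdinal i)
    (h : ∀ x ∈ b, ∃ i ∈ a, G i = x) : Inj b a := by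
  have key : ∀ x ∈ b, IsLeast (fun i => i ∈ a ∧ G i = x) (least fun i => i ∈ a ∧ G i = x) := by
    intro x hx
    obtain ⟨i, hi, hix⟩ := h x hx
    exact least_spec (ha i hi) ⟨hi, hix⟩
  refine ⟨fun x => least fun i => i ∈ a ∧ G i = x, inferInstance, fun x hx => (key x hx).2.1.1,
    fun x hx y hy hxy => ?_⟩
  rw [← (key x hx).2.1.2, ← (key y hy).2.1.2]
  exact congrArg G hxy

theorem IsEnum.inj {F : M → M} {τ A : M} (h : IsEnum F τ A) (hτ : IsOrdinal τ) {i j : M}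
    (hi : i ∈ τ) (hj : j ∈ τ) (hij : F i = F j) : i = j := by
  rcases ord_trichotomy (hτ.mem hi) (hτ.mem hj) with h' | h' | h'
  · exact absurd (hij ▸ h.lt i hi j hj h') mem_irrefl
  · exact h'
  · exact absurd (hij ▸ h.lt j hj i hi h') mem_irrefl

/-- Always take the least remaining element; the remainders shrink, so the values increase. -/
theorem exists_isEnum {A : M} (hA : ∀ x ∈ A, IsOrdinal x) :
    ∃ (τ : M) (F : M → M), IsOrdinal τ ∧ DefFun₁ F ∧ IsEnum F τ A := by
  have key : ∀ B, IsSubset B A → (∃ x, x ∈ B) → IsLeast (fun x => x ∈ B) (least fun x => x ∈ B) := by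
    rintro B hB ⟨x, hx⟩
    exact least_spec (hA x (hB x hx)) hx
  obtain ⟨τ, F, hτ, hF, hFA, hFp, hFs⟩ := exists_enumeration A (fun B => least fun x => x ∈ B)
    fun B hB h => (key B hB h).2.1
  refine ⟨τ, F, hτ, hF, ⟨hFA, ?_, hFs⟩⟩
  intro i hi j hj hij
  obtain ⟨B, hB, hBi, hB'⟩ := hFp i hi
  obtain ⟨C, hC, hCj, hC'⟩ := hFp j hj
  have hBA : IsSubset B A := fun x hx => ((hB' x).1 hx).1
  have hjB : F j ∈ B := by
    have := (hC' _).1 hCj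
    exact (hB' _).2 ⟨this.1, fun k hk => this.2 k ((hτ.mem hj).trans hk hij)⟩
  have := (key B hBA ⟨_, hBi⟩).le (hA _ (hFA j hj)) hjB
  rw [hB] at this
  rcases this with h | h
  · exact h
  · exact absurd h.symm (((hC' _).1 hCj).2 i hij)

/-- If F i < i, then F (F i) < F i by monotonicity, so F i is a smaller counterexample. -/
theorem IsEnum.notMem {F : M → M} {τ A : M} (h : IsEnum F τ A) [DefFun₁ F] (hτ : IsOrdinal τ)
    {i : M} (hi : i ∈ τ) : F i ∉ i := by
  refine ord_induction (fun i => i ∈ τ → F i ∉ i) ?_ (hτ.mem hi) hi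
  intro i hio ih hi hFi
  exact ih _ hFi (hτ.trans hFi hi) (h.lt _ (hτ.trans hFi hi) _ hi hFi)

theorem IsEnum.le {F : M → M} {τ A η : M} (h : IsEnum F τ A) [DefFun₁ F] (hτ : IsOrdinal τ)
    (hη : IsOrdinal η) (hA : IsSubset A η) : τ ∈ η ∨ τ = η :=
  (ord_notMem hη hτ).1 fun h' =>
    h.notMem hτ h' (hA _ (h.mem _ h'))

theorem IsEnum.inj_left {F : M → M} {τ A : M} (h : IsEnum F τ A) [DefFun₁ F] (hτ : IsOrdinal τ) :
    Inj τ A :=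
  ⟨F, inferInstance, h.mem, fun _ hi _ hj hij => h.inj hτ hi hj hij⟩

theorem IsEnum.inj_right {F : M → M} {τ A : M} (h : IsEnum F τ A) [DefFun₁ F] (hτ : IsOrdinal τ) :
    Inj A τ :=
  Inj.of_surj F (fun _ hi => hτ.mem hi) h.surj

theorem isOrderType_iff {A τ : M} :
    IsOrderType A τ ↔ IsOrdinal τ ∧ ∃ F : M → M, DefFun₁ F ∧ IsEnum F τ A := by
  refine and_congr_right fun hτ => ⟨?_, ?_⟩
  · rintro ⟨f, ⟨⟨⟨hf, hfA⟩, _⟩, hsurj⟩, hlt⟩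
    refine ⟨ap f, inferInstance, fun i hi => hfA _ _ (hf.app_ap hi), fun i hi j hj hij => ?_,
      fun x hx => ?_⟩
    · exact hlt _ _ _ _ (hf.app_ap hi) (hf.app_ap hj) hij
    · obtain ⟨i, hi⟩ := hsurj x hx
      rw [hf.app_iff] at hi
      exact ⟨i, hi.1, hi.2.symm⟩
  · rintro ⟨F, hF, h⟩
    refine ⟨lam τ F, ⟨⟨⟨isSeqOn_lam, ?_⟩, ?_⟩, ?_⟩, ?_⟩
    · simp only [app_lam]
      rintro x _ ⟨hx, rfl⟩
      exact h.mem x hx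
    · simp only [app_lam]
      rintro x x' _ ⟨hx, rfl⟩ ⟨hx', h'⟩
      exact h.inj hτ hx hx' h'
    · simp only [app_lam]
      intro y hy
      obtain ⟨i, hi, rfl⟩ := h.surj y hy
      exact ⟨i, hi, rfl⟩
    · simp only [app_lam]
      rintro α β _ _ ⟨hα, rfl⟩ ⟨hβ, rfl⟩ hαβ
      exact h.lt α hα β hβ hαβ

theorem IsInjection.inj {f a b : M} (h : IsInjection f a b) : Inj a b := by
  refine ⟨ap f, inferInstance, fun x hx => h.1.2 _ _ (h.1.1.app_ap hx), fun x hx y hy hxy => ?_⟩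
  exact h.2 x y _ (h.1.1.app_ap hx) (hxy ▸ h.1.1.app_ap hy)

theorem IsBijection.inj_symm {f a b : M} (h : IsBijection f a b) (ha : IsOrdinal a) : Inj b a := by
  refine Inj.of_surj (ap f) (fun i hi => ha.mem hi) fun x hx => ?_
  obtain ⟨i, hi⟩ := h.2 x hx
  rw [h.1.1.1.app_iff] at hi
  exact ⟨i, hi.1, hi.2.symm⟩

/-- The definition excludes only bijections. The image of an injection into α has order type at most
α, and composing its enumeration with the inverse of the injection gives a forbidden bijection. -/
theorem IsCardinal.not_inj {κ α : M} (hκ : IsCardinal κ) (hα : α ∈ κ) : ¬ Inj κ α := by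
  rintro ⟨F, hF, hFα, hFi⟩
  have hαo := hκ.1.mem hα
  have hB : IsSubset (img F κ) α := by
    intro y hy
    obtain ⟨x, hx, rfl⟩ := mem_img.1 hy
    exact hFα x hx
  obtain ⟨τ, e, hτ, he, hen⟩ := exists_isEnum (A := img F κ) fun x hx => hαo.mem (hB x hx)
  have hτκ : τ ∈ κ := by
    rcases hen.le hτ hαo hB with h | rfl
    · exact hκ.1.trans h hα
    · exact hα
  have hG : ∀ x ∈ κ, iota (fun z => z ∈ κ ∧ F z = F x) = x := fun x hx =>
    iota_eq ⟨hx, rfl⟩ fun y hy => hFi y hy.1 x hx hy.2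
  have hG' : ∀ i ∈ τ, ∃ x ∈ κ, e i = F x ∧ iota (fun z => z ∈ κ ∧ F z = e i) = x := by
    intro i hi
    obtain ⟨x, hx, hxi⟩ := mem_img.1 (hen.mem i hi)
    exact ⟨x, hx, hxi, by rw [hxi, hG x hx]⟩
  refine hκ.2 τ hτκ (lam τ fun i => iota fun z => z ∈ κ ∧ F z = e i)
    ⟨⟨⟨isSeqOn_lam, ?_⟩, ?_⟩, ?_⟩
  · simp only [app_lam]
    rintro i _ ⟨hi, rfl⟩
    obtain ⟨x, hx, _, h⟩ := hG' i hi
    rwa [h]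
  · simp only [app_lam]
    rintro i j _ ⟨hi, rfl⟩ ⟨hj, hij⟩
    obtain ⟨x, hx, hxi, h⟩ := hG' i hi
    obtain ⟨y, hy, hyj, h'⟩ := hG' j hj
    refine hen.inj hτ hi hj ?_
    rw [hxi, hyj, ← h, ← h', hij]
  · simp only [app_lam]
    intro x hx
    obtain ⟨i, hi, hix⟩ := hen.surj (F x) (mem_img.2 ⟨x, hx, rfl⟩)
    exact ⟨i, hi, by rw [hix, hG x hx]⟩

/-- The least ordinal into which η injects cannot lie strictly between κ and μ: by minimality it
would be a cardinal there. -/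
theorem IsSuccCardinal.inj {κ μ η : M} (h : IsSuccCardinal κ μ) (hη : η ∈ μ) : Inj η κ := by
  have hηo := h.1.1.mem hη
  have hκo := h.1.1.mem h.2.1
  have hid : IsBijection (lam η fun x => x) η η := by
    refine ⟨⟨⟨isSeqOn_lam, ?_⟩, ?_⟩, ?_⟩ <;> simp only [app_lam]
    · rintro x _ ⟨hx, rfl⟩
      exact hx
    · rintro x y _ ⟨hx, rfl⟩ ⟨hy, rfl⟩
      rfl
    · exact fun y hy => ⟨y, hy, rfl⟩
  have hν := least_spec (P := fun ν => ∃ f, IsInjection f η ν) hηo ⟨_, hid.1⟩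
  set ν := least (fun ν => ∃ f, IsInjection f η ν) with hν_def
  obtain ⟨g, hg⟩ := hν.2.1
  have hνκ : ν ∈ κ ∨ ν = κ := by
    refine (ord_notMem hκo hν.1).1 fun hκν => ?_
    have hνμ : ν ∈ μ := by
      rcases hν.le hηo ⟨_, hid.1⟩ with h' | h'
      · exact h.1.1.trans h' hη
      · rwa [h']
    refine h.2.2 ν hνμ hκν ⟨hν.1, fun α hα f hf => ?_⟩
    obtain ⟨G, hG, hGα, hGi⟩ := hg.inj.trans (hf.inj_symm (hν.1.mem hα))
    refine hν.2.2 α hα ⟨lam η G, ⟨isSeqOn_lam, ?_⟩, ?_⟩ <;> simp only [app_lam]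
    · rintro x _ ⟨hx, rfl⟩
      exact hGα x hx
    · rintro x y _ ⟨hx, rfl⟩ ⟨hy, hxy⟩
      exact hGi x hx y hy hxy
  refine hg.inj.trans (Inj.of_subset ?_)
  exact (ord_subset_iff hν.1 hκo).2 hνκ

end Enumeration

/-! ### Cofinality -/

section Cofinality

/-- The ordinal `δ` has cofinality `κ`, an infinite cardinal. -/
structure HasCof (δ κ : M) : Prop where
  ord : IsOrdinal δ
  card : IsCardinal κ
  limit : IsLimitOrdinal κ
  cof : IsCofinality δ κ

theorem IsRegularCardinal.hasCof {κ : M} (h : IsRegularCardinal κ) : HasCof κ κ :=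
  ⟨h.1.1, h.1, h.2.1, h.2.2⟩

/-- If the image of F were cofinal, its order type would be at least κ, and κ would inject into a <
κ. -/
theorem HasCof.bdd {δ κ a : M} (h : HasCof δ κ) (ha : a ∈ κ) (F : M → M) [DefFun₁ F]
    (hF : ∀ i ∈ a, F i ∈ δ) : ∃ b ∈ δ, ∀ i ∈ a, F i ∈ b := by
  have hB : IsSubset (img F a) δ := by
    intro y hy
    obtain ⟨x, hx, rfl⟩ := mem_img.1 hy
    exact hF x hx
  by_cases hc : IsCofinalIn (img F a) δ
  · exfalso
    obtain ⟨τ, e, hτ, he, hen⟩ := exists_isEnum (A := img F a) fun x hx => h.ord.mem (hB x hx)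
    have hτκ : τ ∉ κ := fun hτκ => h.cof.2 τ hτκ _ hc (isOrderType_iff.2 ⟨hτ, e, he, hen⟩)
    have h1 : Inj κ τ := Inj.of_subset
      ((ord_subset_iff h.card.1 hτ).2 ((ord_notMem hτ h.card.1).1 hτκ))
    have h2 : Inj (img F a) a := by
      refine Inj.of_surj F (fun i hi => (h.card.1.mem ha).mem hi) fun x hx => ?_
      obtain ⟨i, hi, rfl⟩ := mem_img.1 hx
      exact ⟨i, hi, rfl⟩
    exact h.card.not_inj ha ((h1.trans (hen.inj_left hτ)).trans h2)
  · rw [IsCofinalIn] at hc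
    push Not at hc
    obtain ⟨b, hb, hb'⟩ := hc hB
    refine ⟨b, hb, fun i hi => ?_⟩
    have := hb' (F i) (mem_img.2 ⟨i, hi, rfl⟩)
    rcases ord_trichotomy (h.ord.mem (hF i hi)) (h.ord.mem hb) with h' | h' | h'
    · exact h'
    · exact absurd h'.symm this.2
    · exact absurd h' this.1

theorem IsLimitOrdinal.emp_mem {α : M} (h : IsLimitOrdinal α) : emp M ∈ α := by
  rcases ord_trichotomy isOrdinal_emp h.1 with h' | h' | h'
  · exact h'
  · obtain ⟨β, hβ⟩ := h.2.1
    rw [← h'] at hβ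
    exact absurd hβ notMem_emp
  · exact absurd h' notMem_emp

theorem HasCof.isLimitOrdinal {δ κ : M} (h : HasCof δ κ) : IsLimitOrdinal δ := by
  have h0 := h.limit.emp_mem
  refine ⟨h.ord, ?_, fun β hβ => ?_⟩
  · obtain ⟨b, hb, _⟩ := h.bdd h0 (fun x => x) fun i hi => absurd hi notMem_emp
    exact ⟨b, hb⟩
  · obtain ⟨b, hb, hb'⟩ := h.bdd (h.limit.succ_mem h0) (fun _ => β) fun i hi => hβ
    exact ⟨b, hb, hb' (emp M) (by simp)⟩

/-- `E` has elements arbitrarily high below `δ`. -/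
def IsLimitPt (E δ : M) : Prop := ∀ β, β ∈ δ → ∃ γ, γ ∈ E ∧ γ ∈ δ ∧ β ∈ γ

instance {E : Type u} [Env M E] {f g : E → M} [DefFun f] [DefFun g] :
    DefProp M fun e => IsLimitPt (f e) (g e) := by
  unfold IsLimitPt; infer_instance

theorem IsCofinalIn.exists_gt {x δ α : M} (h : IsCofinalIn x δ) (hδ : IsLimitOrdinal δ)
    (hα : α ∈ δ) : ∃ β ∈ x, α ∈ β := by
  obtain ⟨β, hβ, hαβ⟩ := h.2 _ (hδ.succ_mem hα)
  refine ⟨β, hβ, ?_⟩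
  have hs : α ∈ succ α := by simp
  rcases hαβ with h' | rfl
  · exact (hδ.1.mem (h.1 β hβ)).trans hs h'
  · exact hs

/-- The intersection of fewer than `κ` clubs of an ordinal of uncountable cofinality `κ`
is a club. -/
theorem HasCof.isClubIn_inter {δ κ w a : M} (h : HasCof δ κ) (hw : IsOmega w) (hwκ : w ∈ κ)
    (ha : a ∈ κ) (D : M → M) [DefFun₁ D] (hD : ∀ i ∈ a, IsClubIn (D i) δ) :
    IsClubIn (sep δ fun x => ∀ i, i ∈ a → x ∈ D i) δ := by
  have hlim := h.isLimitOrdinal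
  refine ⟨⟨fun x hx => (mem_sep.1 hx).1, fun α hα => ?_⟩, fun α hα hne hα' => ?_⟩
  · let nxt : M → M → M := fun i x => least fun y => y ∈ D i ∧ x ∈ y
    have hnxt : ∀ i ∈ a, ∀ x ∈ δ, nxt i x ∈ D i ∧ x ∈ nxt i x := by
      intro i hi x hx
      obtain ⟨y, hy, hxy⟩ := (hD i hi).1.exists_gt hlim hx
      exact (least_spec (P := fun y => y ∈ D i ∧ x ∈ y)
        (h.ord.mem ((hD i hi).1.1 y hy)) ⟨hy, hxy⟩).2.1
    have hnd : DefFun₂ nxt := by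
      show DefFun₂ fun i x => least fun y => y ∈ D i ∧ x ∈ y
      infer_instance
    let G : M → M := fun x => least fun b => b ∈ δ ∧ ∀ i, i ∈ a → nxt i x ∈ b
    have hGd : DefFun₁ G := by
      show DefFun₁ fun x => least fun b => b ∈ δ ∧ ∀ i, i ∈ a → nxt i x ∈ b
      infer_instance
    have hG : ∀ x ∈ δ, G x ∈ δ ∧ ∀ i, i ∈ a → nxt i x ∈ G x := by
      intro x hx
      obtain ⟨b, hb, hb'⟩ := h.bdd ha (fun i => nxt i x)
        fun i hi => (hD i hi).1.1 _ (hnxt i hi x hx).1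
      exact (least_spec (P := fun b => b ∈ δ ∧ ∀ i, i ∈ a → nxt i x ∈ b) (h.ord.mem hb)
        ⟨hb, hb'⟩).2.1
    -- Recursion sees only the set of earlier values, so the next value is put above α and above `G`
    -- of all of them.
    let H : M → M := fun I => least fun b => b ∈ δ ∧ α ∈ b ∧ ∀ y, y ∈ I → G y ∈ b
    have hHd : DefFun₁ H := by
      show DefFun₁ fun I => least fun b => b ∈ δ ∧ α ∈ b ∧ ∀ y, y ∈ I → G y ∈ b
      infer_instance
    let F := ordRec H
    have hFd : DefFun₁ F := inferInstanceAs (DefFun₁ (ordRec H))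
    have hF : ∀ n, n ∈ w → F n ∈ δ ∧ α ∈ F n ∧ ∀ m, m ∈ n → G (F m) ∈ F n := by
      intro n hn
      refine ord_induction (fun n => n ∈ w → F n ∈ δ ∧ α ∈ F n ∧ ∀ m, m ∈ n → G (F m) ∈ F n)
        ?_ (hw.1.1.mem hn) hn
      intro n hno ih hn
      have ih' : ∀ m ∈ n, F m ∈ δ := fun m hm => (ih m hm (hw.1.1.trans hm hn)).1
      obtain ⟨b, hb, hb'⟩ := h.bdd (h.card.1.trans hn hwκ) (fun m => G (F m))
        fun m hm => (hG _ (ih' m hm)).1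
      obtain ⟨b', hb'δ, hbb', hαb'⟩ : ∃ b' ∈ δ, IsSubset b b' ∧ α ∈ b' := by
        rcases ord_trichotomy (h.ord.mem hb) (h.ord.mem hα) with h' | h' | h'
        · refine ⟨succ α, hlim.succ_mem hα, fun z hz => ?_, by simp⟩
          exact mem_succ.2 (Or.inl ((h.ord.mem hα).trans hz h'))
        · refine ⟨succ α, hlim.succ_mem hα, fun z hz => ?_, by simp⟩
          exact mem_succ.2 (Or.inl (h' ▸ hz))
        · exact ⟨b, hb, fun z hz => hz, h'⟩
      have key := (least_spec (P := fun b => b ∈ δ ∧ α ∈ b ∧ ∀ y, y ∈ img F n → G y ∈ b)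
        (h.ord.mem hb'δ) ⟨hb'δ, hαb', fun y hy => by
          obtain ⟨m, hm, rfl⟩ := mem_img.1 hy
          exact hbb' _ (hb' m hm)⟩).2.1
      have hFn : F n = least fun b => b ∈ δ ∧ α ∈ b ∧ ∀ y, y ∈ img F n → G y ∈ b :=
        ordRec_eq H hno
      rw [hFn]
      exact ⟨key.1, key.2.1, fun m hm => key.2.2 _ (mem_img.2 ⟨m, hm, rfl⟩)⟩
    -- As ω < κ, the supremum of the ω steps stays below δ. It is a limit of every `D i`, because
    -- `nxt i (F n)` lies between `F n` and the next step.
    obtain ⟨b, hb, hb'⟩ := h.bdd hwκ F fun n hn => (hF n hn).1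
    have hs : ∀ z, z ∈ sUnion (img F w) ↔ ∃ n ∈ w, z ∈ F n := by
      intro z
      rw [mem_sUnion]
      constructor
      · rintro ⟨y, hy, hz⟩
        obtain ⟨n, hn, rfl⟩ := mem_img.1 hy
        exact ⟨n, hn, hz⟩
      · rintro ⟨n, hn, hz⟩
        exact ⟨F n, mem_img.2 ⟨n, hn, rfl⟩, hz⟩
    have hso : IsOrdinal (sUnion (img F w)) := isOrdinal_sUnion fun y hy => by
      obtain ⟨n, hn, rfl⟩ := mem_img.1 hy
      exact h.ord.mem (hF n hn).1
    have hsδ : sUnion (img F w) ∈ δ := by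
      have hsb : IsSubset (sUnion (img F w)) b := by
        intro z hz
        obtain ⟨n, hn, hz⟩ := (hs z).1 hz
        exact (h.ord.mem hb).trans hz (hb' n hn)
      rcases (ord_subset_iff hso (h.ord.mem hb)).1 hsb with h' | h'
      · exact h.ord.trans h' hb
      · rwa [h']
    have hαs : α ∈ sUnion (img F w) :=
      (hs α).2 ⟨_, hw.1.emp_mem, (hF _ hw.1.emp_mem).2.1⟩
    refine ⟨_, mem_sep.2 ⟨hsδ, fun i hi => (hD i hi).2 _ hsδ ⟨α, hαs⟩ fun β hβ => ?_⟩, Or.inl hαs⟩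
    obtain ⟨n, hn, hβn⟩ := (hs β).1 hβ
    have hFn := (hF n hn).1
    have h1 := hnxt i hi _ hFn
    refine ⟨nxt i (F n), h1.1, (hs _).2 ⟨succ n, hw.1.succ_mem hn, ?_⟩, ?_⟩
    · exact (h.ord.mem (hF _ (hw.1.succ_mem hn)).1).trans ((hG _ hFn).2 i hi)
        ((hF _ (hw.1.succ_mem hn)).2.2 n (by simp))
    · exact (h.ord.mem ((hD i hi).1.1 _ h1.1)).trans hβn h1.2
  · refine mem_sep.2 ⟨hα, fun i hi => (hD i hi).2 α hα hne fun β hβ => ?_⟩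
    obtain ⟨γ, hγ, h'⟩ := hα' β hβ
    exact ⟨γ, (mem_sep.1 hγ).2 i hi, h'⟩

/-- By regularity E has order type at least λ, so it has an element of index θ, which bounds the
first θ elements. Their supremum is the required δ, and regularity of θ makes its cofinality exactly
θ. -/
theorem exists_isLimitPt {E lam θ : M} (hlam : IsRegularCardinal lam) (hθ : IsRegularCardinal θ)
    (hθlam : θ ∈ lam) (hE : IsCofinalIn E lam) : ∃ δ ∈ lam, IsCofinality δ θ ∧ IsLimitPt E δ := by
  have hEo : ∀ x ∈ E, IsOrdinal x := fun x hx => hlam.1.1.mem (hE.1 x hx)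
  obtain ⟨τ, F, hτ, hF, hen⟩ := exists_isEnum hEo
  have hτlam : τ ∉ lam := fun hτlam =>
    hlam.2.2.2 τ hτlam E hE (isOrderType_iff.2 ⟨hτ, F, hF, hen⟩)
  have hθτ : θ ∈ τ := by
    rcases (ord_notMem hτ hlam.1.1).1 hτlam with h | h
    · exact hτ.trans hθlam h
    · rwa [← h]
  have hmem : ∀ i ∈ θ, i ∈ τ := fun i hi => hτ.trans hi hθτ
  have hs : ∀ z, z ∈ sUnion (img F θ) ↔ ∃ n ∈ θ, z ∈ F n := by
    intro z
    rw [mem_sUnion]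
    constructor
    · rintro ⟨y, hy, hz⟩
      obtain ⟨n, hn, rfl⟩ := mem_img.1 hy
      exact ⟨n, hn, hz⟩
    · rintro ⟨n, hn, hz⟩
      exact ⟨F n, mem_img.2 ⟨n, hn, rfl⟩, hz⟩
  have hso : IsOrdinal (sUnion (img F θ)) := isOrdinal_sUnion fun y hy => by
    obtain ⟨n, hn, rfl⟩ := mem_img.1 hy
    exact hEo _ (hen.mem n (hmem n hn))
  have hFs : ∀ i ∈ θ, F i ∈ sUnion (img F θ) := fun i hi =>
    (hs _).2 ⟨_, hθ.2.1.succ_mem hi,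
      hen.lt _ (hmem i hi) _ (hmem _ (hθ.2.1.succ_mem hi)) (by simp)⟩
  have hEs : IsLimitPt E (sUnion (img F θ)) := by
    intro β hβ
    obtain ⟨n, hn, hβn⟩ := (hs β).1 hβ
    exact ⟨F n, hen.mem n (hmem n hn), hFs n hn, hβn⟩
  refine ⟨_, ?_, ⟨⟨img F θ, ⟨fun y hy => ?_, fun β hβ => ?_⟩, ?_⟩, fun η hη x hx hxη => ?_⟩, hEs⟩
  · have hFθ := hen.mem θ hθτ
    have hsub : IsSubset (sUnion (img F θ)) (F θ) := by
      intro z hz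
      obtain ⟨n, hn, hz⟩ := (hs z).1 hz
      exact (hEo _ hFθ).trans hz (hen.lt n (hmem n hn) θ hθτ hn)
    rcases (ord_subset_iff hso (hEo _ hFθ)).1 hsub with h | h
    · exact hlam.1.1.trans h (hE.1 _ hFθ)
    · rw [h]
      exact hE.1 _ hFθ
  · obtain ⟨n, hn, rfl⟩ := mem_img.1 hy
    exact hFs n hn
  · obtain ⟨n, hn, hβn⟩ := (hs β).1 hβ
    exact ⟨F n, mem_img.2 ⟨n, hn, rfl⟩, Or.inl hβn⟩
  · refine isOrderType_iff.2 ⟨hθ.1.1, F, hF, fun i hi => mem_img.2 ⟨i, hi, rfl⟩,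
      fun i hi j hj hij => hen.lt i (hmem i hi) j (hmem j hj) hij, fun y hy => ?_⟩
    obtain ⟨n, hn, rfl⟩ := mem_img.1 hy
    exact ⟨n, hn, rfl⟩
  · obtain ⟨hηo, e, he, hex⟩ := isOrderType_iff.1 hxη
    -- A cofinal set of type η < θ would give η indices in θ, which are bounded by some b < θ; then
    -- the set lies below `F b`.
    have hG : ∀ ξ ∈ η, IsLeast (fun i => i ∈ θ ∧ e ξ ∈ F i) (least fun i => i ∈ θ ∧ e ξ ∈ F i) := by
      intro ξ hξ
      obtain ⟨n, hn, h⟩ := (hs _).1 (hx.1 _ (hex.mem ξ hξ))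
      exact least_spec (hθ.1.1.mem hn) ⟨hn, h⟩
    obtain ⟨b, hb, hb'⟩ := hθ.hasCof.bdd hη (fun ξ => least fun i => i ∈ θ ∧ e ξ ∈ F i)
      fun ξ hξ => (hG ξ hξ).2.1.1
    obtain ⟨β, hβ, hbβ⟩ := hx.2 _ (hFs b hb)
    obtain ⟨ξ, hξ, rfl⟩ := hex.surj β hβ
    have h1 : e ξ ∈ F b := (hEo _ (hen.mem b (hmem b hb))).trans (hG ξ hξ).2.1.2
      (hen.lt _ (hmem _ (hG ξ hξ).2.1.1) b (hmem b hb) (hb' ξ hξ))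
    rcases hbβ with h | h
    · exact mem_asymm h h1
    · rw [h] at h1
      exact mem_irrefl h1

end Cofinality

/-! ### Sets with finite fibres over `ω` -/

section Fibres

/-- A set of ordinals that maps to `ω` in such a way that all nonempty subsets of fibres have a
greatest element (that is, fibres are finite) injects into `ω`. -/
theorem inj_omega_of_finite_fibres {w A : M} (hw : IsOmega w) (hwc : IsCardinal w)
    (hA : ∀ x ∈ A, IsOrdinal x) (n : M → M) [DefFun₁ n] (hn : ∀ x ∈ A, n x ∈ w)
    (hfib : ∀ k ∈ w, ∀ B, IsSubset B A → (∃ x, x ∈ B) → (∀ x ∈ B, n x = k) →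
      ∃ m ∈ B, ∀ x ∈ B, x ∈ m ∨ x = m) : Inj A w := by
  -- The union of the first k fibres is finite, in the sense that its nonempty subsets have greatest
  -- elements.
  have hmax : ∀ k, k ∈ w → ∀ B, IsSubset B A → (∃ x, x ∈ B) → (∀ x, x ∈ B → n x ∈ k) →
      ∃ m, m ∈ B ∧ ∀ x, x ∈ B → x ∈ m ∨ x = m := by
    intro k hk
    refine omega_induction hw (fun k => ∀ B, IsSubset B A → (∃ x, x ∈ B) →
      (∀ x, x ∈ B → n x ∈ k) → ∃ m, m ∈ B ∧ ∀ x, x ∈ B → x ∈ m ∨ x = m) ?_ ?_ hk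
    · rintro B _ ⟨x, hx⟩ h
      exact absurd (h x hx) notMem_emp
    · intro k hk ih B hBA hne hB
      by_cases h0 : ∃ x, x ∈ sep B fun x => n x ∈ k
      · obtain ⟨m, hm, hm'⟩ := ih (sep B fun x => n x ∈ k) (fun x hx => hBA x (mem_sep.1 hx).1) h0
          fun x hx => (mem_sep.1 hx).2
        by_cases h1 : ∃ x, x ∈ sep B fun x => n x = k
        · obtain ⟨l, hl, hl'⟩ := hfib k hk (sep B fun x => n x = k)
            (fun x hx => hBA x (mem_sep.1 hx).1) h1 fun x hx => (mem_sep.1 hx).2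
          have hmB := (mem_sep.1 hm).1
          have hlB := (mem_sep.1 hl).1
          have hmo := hA m (hBA m hmB)
          have hlo := hA l (hBA l hlB)
          have hcase : ∀ x ∈ B, (x ∈ m ∨ x = m) ∨ (x ∈ l ∨ x = l) := by
            intro x hx
            rcases mem_succ.1 (hB x hx) with h | h
            · exact Or.inl (hm' x (mem_sep.2 ⟨hx, h⟩))
            · exact Or.inr (hl' x (mem_sep.2 ⟨hx, h⟩))
          rcases ord_trichotomy hmo hlo with h | h | h
          · refine ⟨l, hlB, fun x hx => ?_⟩
            rcases hcase x hx with (h' | rfl) | h'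
            · exact Or.inl (hlo.trans h' h)
            · exact Or.inl h
            · exact h'
          · refine ⟨l, hlB, fun x hx => ?_⟩
            rcases hcase x hx with h' | h'
            · rwa [h] at h'
            · exact h'
          · refine ⟨m, hmB, fun x hx => ?_⟩
            rcases hcase x hx with h' | (h' | rfl)
            · exact h'
            · exact Or.inl (hmo.trans h' h)
            · exact Or.inl h
        · refine ⟨m, (mem_sep.1 hm).1, fun x hx => ?_⟩
          rcases mem_succ.1 (hB x hx) with h | h
          · exact hm' x (mem_sep.2 ⟨hx, h⟩)
          · exact absurd ⟨x, mem_sep.2 ⟨hx, h⟩⟩ h1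
      · refine hfib k hk B hBA hne fun x hx => ?_
        rcases mem_succ.1 (hB x hx) with h | h
        · exact absurd ⟨x, mem_sep.2 ⟨hx, h⟩⟩ h0
        · exact h
  let q : M → M := fun B => least fun k => ∃ y, y ∈ B ∧ n y = k
  have hqd : DefFun₁ q := by
    show DefFun₁ fun B => least fun k => ∃ y, y ∈ B ∧ n y = k
    infer_instance
  have hq : ∀ B, IsSubset B A → (∃ x, x ∈ B) → IsLeast (fun k => ∃ y, y ∈ B ∧ n y = k) (q B) := by
    rintro B hB ⟨x, hx⟩
    exact least_spec (P := fun k => ∃ y, y ∈ B ∧ n y = k) (hw.1.1.mem (hn x (hB x hx)))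
      ⟨x, hx, rfl⟩
  have hp : ∀ B, IsSubset B A → (∃ x, x ∈ B) →
      IsLeast (fun x => x ∈ B ∧ n x = q B) (least fun x => x ∈ B ∧ n x = q B) := by
    intro B hB hne
    obtain ⟨y, hy, hyq⟩ := (hq B hB hne).2.1
    exact least_spec (P := fun x => x ∈ B ∧ n x = q B) (hA y (hB y hy)) ⟨hy, hyq⟩
  -- Enumerate `A` lexicographically, by the value of `n` and then by size. It remains to see that
  -- the length is at most ω.
  obtain ⟨τ, F, hτ, hF, hFA, hFp, hFs⟩ := exists_enumeration A
    (fun B => least fun x => x ∈ B ∧ n x = q B) fun B hB hne => (hp B hB hne).2.1.1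
  have hinj : Inj A τ := Inj.of_surj F (fun i hi => hτ.mem hi) hFs
  have hFne : ∀ i ∈ τ, ∀ j ∈ i, F i ≠ F j := by
    intro i hi j hj
    obtain ⟨B, _, hiB, hB⟩ := hFp i hi
    exact ((hB _).1 hiB).2 j hj
  -- If there were a term with index ω, the terms before it would be infinitely many points with
  -- `n`-values at most `n (F w)`.
  by_cases hwτ : w ∈ τ
  · exfalso
    have hN := hn _ (hFA w hwτ)
    have hBA : IsSubset (img F w) A := by
      intro y hy
      obtain ⟨i, hi, rfl⟩ := mem_img.1 hy
      exact hFA i (hτ.trans hi hwτ)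
    have hBN : ∀ x ∈ img F w, n x ∈ succ (n (F w)) := by
      intro y hy
      obtain ⟨i, hi, rfl⟩ := mem_img.1 hy
      obtain ⟨B, hBi, hiB, hB⟩ := hFp i (hτ.trans hi hwτ)
      obtain ⟨C, _, hwC, hC⟩ := hFp w hwτ
      have hwB : F w ∈ B := by
        refine (hB _).2 ⟨hFA w hwτ, fun j hj => ((hC _).1 hwC).2 j (hw.1.1.trans hj hi)⟩
      have hBs : IsSubset B A := fun x hx => ((hB x).1 hx).1
      have h1 := (hp B hBs ⟨_, hwB⟩).2.1.2
      have h2 := (hq B hBs ⟨_, hwB⟩).le (hw.1.1.mem hN) ⟨_, hwB, rfl⟩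
      change least (fun x => x ∈ B ∧ n x = q B) = F i at hBi
      rw [hBi] at h1
      rw [h1, mem_succ]
      exact h2
    have hBo : ∀ x ∈ img F w, IsOrdinal x := fun x hx => hA x (hBA x hx)
    obtain ⟨σ, e, hσ, he, hen⟩ := exists_isEnum hBo
    have hwB : Inj w (img F w) := by
      refine ⟨F, hF, fun x hx => mem_img.2 ⟨x, hx, rfl⟩, fun i hi j hj hij => ?_⟩
      rcases ord_trichotomy (hw.1.1.mem hi) (hw.1.1.mem hj) with h | h | h
      · exact absurd hij.symm (hFne j (hτ.trans hj hwτ) i h)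
      · exact h
      · exact absurd hij (hFne i (hτ.trans hi hwτ) j h)
    -- Either this infinite set has order type below ω, contradicting that ω is a cardinal, or its
    -- first ω elements in increasing order have no maximum, contradicting `hmax`.
    by_cases hσw : σ ∈ w
    · exact hwc.not_inj hσw (hwB.trans (hen.inj_right hσ))
    · have hsub := (ord_subset_iff hw.1.1 hσ).2 ((ord_notMem hσ hw.1.1).1 hσw)
      have hsub' : IsSubset (img e w) (img F w) := by
        intro y hy
        obtain ⟨i, hi, rfl⟩ := mem_img.1 hy
        exact hen.mem i (hsub i hi)
      obtain ⟨m, hm, hm'⟩ := hmax _ (hw.1.succ_mem hN) (img e w)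
        (fun y hy => hBA y (hsub' y hy)) ⟨_, mem_img.2 ⟨_, hw.1.emp_mem, rfl⟩⟩
        fun x hx => hBN x (hsub' x hx)
      obtain ⟨i, hi, rfl⟩ := mem_img.1 hm
      have h1 := hm' _ (mem_img.2 ⟨_, hw.1.succ_mem hi, rfl⟩)
      have h2 := hen.lt i (hsub i hi) _ (hsub _ (hw.1.succ_mem hi)) (by simp)
      rcases h1 with h1 | h1
      · exact mem_asymm h1 h2
      · rw [h1] at h2
        exact mem_irrefl h2
  · exact hinj.trans (Inj.of_subset ((ord_subset_iff hτ hw.1.1).2 ((ord_notMem hw.1.1 hτ).1 hwτ)))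

end Fibres

/-! ### Dependent choice for definable relations -/

section Choice

theorem lam_ap_lam {a b : M} {F : M → M} [DefFun₁ F] (h : IsSubset b a) :
    lam b (ap (lam a F)) = lam b F :=
  lam_congr fun x hx => ap_lam (h x hx)

/-- From `DC_μ`, a sequence of length `μ` each of whose terms is related to the sequence of
its predecessors. -/
theorem DependentChoice.exists_seq {μ : M} (hDC : DependentChoice μ) (hμ : IsLimitOrdinal μ)
    (X : M) (R : M → M → Prop) [DefProp₂ R]
    (hR : ∀ η ∈ μ, ∀ f, IsMap f η X → (∀ β ∈ η, R (lam β (ap f)) (ap f β)) → ∃ y ∈ X, R f y) :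
    ∃ F : M → M, DefFun₁ F ∧ ∀ α ∈ μ, F α ∈ X ∧ R (lam α F) (F α) := by
  -- This is μ × X; its powerset bounds the tree, so that the tree is a set.
  let pairs := sUnion (img (fun x => img (fun y => opair x y) X) μ)
  have hpairs : ∀ x ∈ μ, ∀ y ∈ X, opair x y ∈ pairs := fun x hx y hy =>
    mem_sUnion.2 ⟨_, mem_img.2 ⟨x, hx, rfl⟩, mem_img.2 ⟨y, hy, rfl⟩⟩
  let good : M → M → Prop := fun f η =>
    η ∈ μ ∧ IsMap f η X ∧ ∀ β, β ∈ η → R (lam β (ap f)) (ap f β)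
  have hgd : DefProp₂ good := by
    show DefProp₂ fun f η => η ∈ μ ∧ IsMap f η X ∧ ∀ β, β ∈ η → R (lam β (ap f)) (ap f β)
    infer_instance
  let T := sep (pow pairs) fun f => ∃ η, good f η
  have hT : ∀ f, f ∈ T ↔ ∃ η, good f η := by
    intro f
    refine mem_sep.trans ⟨fun h => h.2, fun h => ⟨mem_pow.2 ?_, h⟩⟩
    obtain ⟨η, hη, hf, -⟩ := h
    intro p hp
    obtain ⟨x, hx, rfl⟩ := hf.1.mem_iff.1 hp
    exact hpairs x (hμ.1.trans hx hη) _ (hf.2 _ _ (hf.1.app_ap hx))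
  have hrestr : ∀ f η α, good f η → α ∈ η → good (lam α (ap f)) α := by
    rintro f η α ⟨hη, hf, hfR⟩ hα
    have hηo := hμ.1.mem hη
    refine ⟨hμ.1.trans hα hη, ⟨isSeqOn_lam, fun x y hxy => ?_⟩, fun β hβ => ?_⟩
    · obtain ⟨hx, rfl⟩ := app_lam.1 hxy
      exact hf.2 _ _ (hf.1.app_ap (hηo.trans hx hα))
    · rw [ap_lam hβ, lam_ap_lam ((hηo.mem hα).subset hβ)]
      exact hfR β (hηo.trans hβ hα)
  have htree : IsTree T := by
    intro f hf
    obtain ⟨η, hfη⟩ := (hT f).1 hf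
    have hηo := hμ.1.mem hfη.1
    refine ⟨η, hηo, hfη.2.1.1, fun α hα => ⟨_, (hT _).2 ⟨α, hrestr f η α hfη hα⟩, ?_⟩⟩
    exact (hfη.2.1.1.isRestriction_iff (hηo.subset hα)).2 rfl
  obtain ⟨b, ⟨hbT, hbc⟩, hbmax⟩ := hDC X T htree fun f hf => by
    obtain ⟨η, hη, hf, -⟩ := (hT f).1 hf
    exact ⟨η, hη, hf⟩
  let F : M → M := fun x => iota fun y => ∃ f, f ∈ b ∧ App f x y
  have hFd : DefFun₁ F := by
    show DefFun₁ fun x => iota fun y => ∃ f, f ∈ b ∧ App f x y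
    infer_instance
  have hF : ∀ f ∈ b, ∀ η, good f η → ∀ x ∈ η, F x = ap f x := by
    intro f hf η hη x hx
    refine iota_eq ⟨f, hf, hη.2.1.1.app_ap hx⟩ ?_
    rintro y ⟨g, hg, hgy⟩
    have hfx := hη.2.1.1.app_ap hx
    obtain ⟨ζ, hζ⟩ := (hT g).1 (hbT g hg)
    rw [app_iff] at hgy hfx
    rcases hbc f hf g hg with h | h
    · exact hζ.2.1.1.1.2 x _ _ (app_iff.2 hgy) (app_iff.2 (h _ hfx))
    · exact hη.2.1.1.1.2 x _ _ (app_iff.2 (h _ hgy)) (app_iff.2 hfx)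
  have hstep : ∀ α, (∃ f, f ∈ b ∧ ∃ η, good f η ∧ α ∈ η) → F α ∈ X ∧ R (lam α F) (F α) := by
    rintro α ⟨f, hf, η, hη, hα⟩
    have hηo := hμ.1.mem hη.1
    rw [hF f hf η hη α hα, lam_congr fun x hx => hF f hf η hη x (hηo.trans hx hα)]
    exact ⟨hη.2.1.2 _ _ (hη.2.1.1.app_ap hα), hη.2.2 α hα⟩
  refine ⟨F, hFd, fun α hα => hstep α ?_⟩
  by_contra hcon
  have hleast := least_spec (P := fun α => α ∈ μ ∧ ¬ ∃ f, f ∈ b ∧ ∃ η, good f η ∧ α ∈ η)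
    (hμ.1.mem hα) ⟨hα, hcon⟩
  -- If the union `F` of the branch stops at η < μ, extending it by one value at η yields a node
  -- above the whole branch, against maximality.
  set η := least fun α => α ∈ μ ∧ ¬ ∃ f, f ∈ b ∧ ∃ η, good f η ∧ α ∈ η
  obtain ⟨hηo, ⟨hη, hηb⟩, hmin⟩ := hleast
  have hbelow : ∀ β ∈ η, F β ∈ X ∧ R (lam β F) (F β) := by
    intro β hβ
    have := hmin β hβ
    push Not at this
    exact hstep β (this (hμ.1.trans hβ hη))
  obtain ⟨y, hy, hRy⟩ := hR η hη (lam η F)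
    ⟨isSeqOn_lam, fun x y hxy => by
      obtain ⟨hx, rfl⟩ := app_lam.1 hxy
      exact (hbelow x hx).1⟩
    fun β hβ => by
      rw [ap_lam hβ, lam_ap_lam (hηo.subset hβ)]
      exact (hbelow β hβ).2
  let G : M → M := fun x => iota fun z => (x = η ∧ z = y) ∨ (x ≠ η ∧ z = F x)
  have hGd : DefFun₁ G := by
    show DefFun₁ fun x => iota fun z => (x = η ∧ z = y) ∨ (x ≠ η ∧ z = F x)
    infer_instance
  have hGη : G η = y := iota_eq (Or.inl ⟨rfl, rfl⟩) (by rintro z (h | h) <;> grind)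
  have hGF : ∀ x ∈ η, G x = F x := by
    intro x hx
    have hne : x ≠ η := fun h => mem_irrefl (h ▸ hx)
    exact iota_eq (Or.inr ⟨hne, rfl⟩) (by rintro z (h | h) <;> grind)
  have hηs : η ∈ succ η := by simp
  have hsub : IsSubset η (succ η) := fun x hx => mem_succ.2 (Or.inl hx)
  have hgood : good (lam (succ η) G) (succ η) := by
    -- The extension is still in the tree because μ is a limit.
    refine ⟨hμ.succ_mem hη, ⟨isSeqOn_lam, fun x z hxz => ?_⟩, fun β hβ => ?_⟩
    · obtain ⟨hx, rfl⟩ := app_lam.1 hxz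
      rcases mem_succ.1 hx with h | rfl
      · rw [hGF x h]
        exact (hbelow x h).1
      · rwa [hGη]
    · rw [ap_lam hβ, lam_ap_lam (hηo.succ.subset hβ)]
      rcases mem_succ.1 hβ with h | h
      · rw [hGF β h, lam_congr fun x hx => hGF x (hηo.trans hx h)]
        exact (hbelow β h).2
      · rw [h, hGη, lam_congr hGF]
        exact hRy
  have hle : ∀ f ∈ b, IsSubset f (lam (succ η) G) := by
    intro f hf
    obtain ⟨ζ, hζ⟩ := (hT f).1 (hbT f hf)
    have hζo := hμ.1.mem hζ.1
    have hζη : IsSubset ζ η := by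
      refine (ord_subset_iff hζo hηo).2 ((ord_notMem hηo hζo).1 fun h => ?_)
      exact hηb ⟨f, hf, ζ, hζ, h⟩
    rw [hζ.2.1.1.eq_lam]
    refine lam_subset (fun x hx => hsub x (hζη x hx)) fun x hx => ?_
    rw [hGF x (hζη x hx), hF f hf ζ hζ x hx]
  have hb' := hbmax (union b (upair (lam (succ η) G) (lam (succ η) G)))
    ⟨fun f hf => by
      simp only [mem_union, mem_upair, or_self] at hf
      rcases hf with h | rfl
      · exact hbT f h
      · exact (hT _).2 ⟨_, hgood⟩,
    fun f hf g hg => by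
      simp only [mem_union, mem_upair, or_self] at hf hg
      rcases hf with hf | rfl
      · rcases hg with hg | rfl
        · exact hbc f hf g hg
        · exact Or.inl (hle f hf)
      · rcases hg with hg | rfl
        · exact Or.inr (hle g hg)
        · exact Or.inl fun z hz => hz⟩
    fun f hf => mem_union.2 (Or.inl hf)
  refine hηb ⟨lam (succ η) G, ?_, succ η, hgood, hηs⟩
  rw [← hb']
  simp

end Choice

/-! ### Club guessing -/

section Guessing

theorem IsLimitPt.mono {E E' δ : M} (h : IsLimitPt E δ) (hE : IsSubset E E') : IsLimitPt E' δ :=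
  fun β hβ => by
    obtain ⟨γ, hγ, h'⟩ := h β hβ
    exact ⟨γ, hE γ hγ, h'⟩

/-- If no club `E` of `κ` makes the sequence `δ ↦ d E δ` guess clubs, then there are a sequence of
counterexamples `D α`, each to the intersection of the previous ones, and a point of `S` that is
a limit point of all these intersections. -/
theorem exists_counterexamples {θ μ κ S : M} (hθ : IsRegularCardinal θ)
    (hκ : IsRegularCardinal κ) (hθκ : θ ∈ κ) (hμ : IsLimitOrdinal μ) (hμκ : μ ∈ κ)
    (hDC : DependentChoice μ) (hS : IsCofinalitySet κ θ S) (d : M → M → M) [DefFun₂ d]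
    (hd : ∀ E, IsClubIn E κ → ∃ D, IsClubIn D κ ∧ ∀ δ ∈ S, ¬ IsSubset (d E δ) D) :
    ∃ (D : M → M) (δ : M), DefFun₁ D ∧ δ ∈ S ∧ ∀ α ∈ μ,
      IsClubIn (sep κ fun x => ∀ β, β ∈ α → x ∈ D β) κ ∧
      IsLimitPt (sep κ fun x => ∀ β, β ∈ α → x ∈ D β) δ ∧
      ¬ IsSubset (d (sep κ fun x => ∀ β, β ∈ α → x ∈ D β) δ) (D α) := by
  obtain ⟨w, hw, hwθ⟩ := exists_isOmega hθ.2.1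
  have hwκ : w ∈ κ := by
    rcases hwθ with h | rfl
    · exact hκ.1.1.trans h hθκ
    · exact hθκ
  -- Relative to κ, so the empty sequence has intersection κ.
  let inter : M → M := fun f => sep κ fun x => ∀ β y, App f β y → x ∈ y
  have hid : DefFun₁ inter := by
    show DefFun₁ fun f => sep κ fun x => ∀ β y, App f β y → x ∈ y
    infer_instance
  have hinter : ∀ (a : M) (F : M → M) [DefFun₁ F],
      inter (lam a F) = sep κ fun x => ∀ β, β ∈ a → x ∈ F β := by
    intro a F _
    refine ext_mem fun x => ?_
    rw [mem_sep, mem_sep]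
    refine and_congr_right fun _ => ⟨fun h β hβ => h β _ (app_lam.2 ⟨hβ, rfl⟩), ?_⟩
    intro h β y hy
    obtain ⟨hβ, rfl⟩ := app_lam.1 hy
    exact h β hβ
  obtain ⟨D, hDd, hD⟩ := hDC.exists_seq hμ (pow κ)
    (fun f y => IsClubIn y κ ∧ ∀ δ, δ ∈ S → ¬ IsSubset (d (inter f) δ) y) (by
      intro η hη f hf hfR
      have hclub := hκ.hasCof.isClubIn_inter hw hwκ (hκ.1.1.trans hη hμκ) (ap f)
        fun β hβ => (hfR β hβ).1
      rw [← hinter, ← hf.1.eq_lam] at hclub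
      obtain ⟨D, hD, hD'⟩ := hd _ hclub
      exact ⟨D, mem_pow.2 hD.1.1, hD, hD'⟩)
  have hEclub : ∀ α, α ∈ κ → IsSubset α μ → IsClubIn (sep κ fun x => ∀ β, β ∈ α → x ∈ D β) κ :=
    fun α hα hαμ => hκ.hasCof.isClubIn_inter hw hwκ hα D fun β hβ => (hD β (hαμ β hβ)).2.1
  -- A limit point of the intersection of all μ clubs, a club since μ < κ, is a limit point of every
  -- partial intersection.
  obtain ⟨δ, hδκ, hδ, hlim⟩ :=
    exists_isLimitPt hκ hθ hθκ (hEclub μ hμκ fun x hx => hx).1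
  have hδS : δ ∈ S := (hS δ).2 ⟨hδκ, hδ⟩
  refine ⟨D, δ, hDd, hδS, fun α hα => ⟨?_, ?_, ?_⟩⟩
  · exact hEclub α (hκ.1.1.trans hα hμκ) (hμ.1.subset hα)
  · refine hlim.mono fun x hx => ?_
    rw [mem_sep] at hx ⊢
    exact ⟨hx.1, fun β hβ => hx.2 β (hμ.1.trans hβ hα)⟩
  · have := (hD α hα).2.2 δ hδS
    rwa [hinter] at this

/-- The greatest element of `E` that is at most `γ` is `x`. -/
def IsDrop (E γ x : M) : Prop :=
  x ∈ E ∧ (x ∈ γ ∨ x = γ) ∧ ∀ y, y ∈ E → (y ∈ γ ∨ y = γ) → y ∈ x ∨ y = x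

instance {E : Type u} [Env M E] {f g h : E → M} [DefFun f] [DefFun g] [DefFun h] :
    DefProp M fun e => IsDrop (f e) (g e) (h e) := by
  unfold IsDrop; infer_instance

/-- The supremum of E ∩ (γ + 1) belongs to E because E is closed; `b` ensures that this set is
nonempty. -/
theorem IsClubIn.exists_isDrop {E κ γ b : M} (hE : IsClubIn E κ) (hκ : IsOrdinal κ) (hγ : γ ∈ κ)
    (hb : b ∈ E) (hbγ : b ∈ γ ∨ b = γ) : ∃ x, IsDrop E γ x := by
  have hγo := hκ.mem hγ
  have hEo : ∀ y ∈ E, IsOrdinal y := fun y hy => hκ.mem (hE.1.1 y hy)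
  have hs := least_spec (P := fun s => ∀ y, y ∈ E → (y ∈ γ ∨ y = γ) → y ∈ s ∨ y = s) hγo
    fun y _ h => h
  have hsγ := hs.le hγo fun y _ h => h
  set s := least fun s => ∀ y, y ∈ E → (y ∈ γ ∨ y = γ) → y ∈ s ∨ y = s
  obtain ⟨hso, hub, hmin⟩ := hs
  refine ⟨s, ?_, hsγ, hub⟩
  by_contra hsE
  have hlt : ∀ y ∈ E, (y ∈ γ ∨ y = γ) → y ∈ s := by
    intro y hy h
    rcases hub y hy h with h' | rfl
    · exact h'
    · exact absurd hy hsE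
  refine hsE (hE.2 s ?_ ⟨b, hlt b hb hbγ⟩ fun β hβ => ?_)
  · rcases hsγ with h | h
    · exact hκ.trans h hγ
    · rwa [h]
  · have := hmin β hβ
    push Not at this
    obtain ⟨y, hy, hyγ, h1, h2⟩ := this
    refine ⟨y, hy, hlt y hy hyγ, ?_⟩
    rcases (ord_notMem (hEo y hy) (hso.mem hβ)).1 h1 with h | h
    · exact h
    · exact absurd h.symm h2

/-! ### The guessing sequences for uncountable and for countable θ -/

variable {θ μ κ S c : M}

theorem isUncountable_or_isOmega (hθ : IsRegularCardinal θ) :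
    (IsUncountable θ ∧ ∃ w, IsOmega w ∧ w ∈ θ) ∨ (¬ IsUncountable θ ∧ IsOmega θ) := by
  obtain ⟨w, hw, hwθ⟩ := exists_isOmega hθ.2.1
  rcases hwθ with h | rfl
  · refine Or.inl ⟨fun w' f hw' hf => ?_, w, hw, h⟩
    refine hθ.1.not_inj ?_ hf.inj
    rcases ord_trichotomy hw.1.1 hw'.1.1 with h' | rfl | h'
    · exact absurd hw.1 (hw'.2 _ h')
    · exact h
    · exact hθ.1.1.trans h' h
  · refine Or.inr ⟨fun h => h w (lam w fun x => x) hw ⟨⟨isSeqOn_lam, ?_⟩, ?_⟩, hw⟩ <;>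
    simp only [app_lam]
    · rintro x _ ⟨hx, rfl⟩
      exact hx
    · rintro x y _ ⟨hx, rfl⟩ ⟨hy, rfl⟩
      rfl

theorem exists_club_of_not_guessesClubs {d : M → M} [DefFun₁ d] (h : ¬ GuessesClubs (lam S d) S κ) :
    ∃ D, IsClubIn D κ ∧ ∀ δ ∈ S, ¬ IsSubset (d δ) D := by
  rw [GuessesClubs] at h
  push Not at h
  obtain ⟨D, hD, h⟩ := h
  exact ⟨D, hD, fun δ hδ => h δ hδ _ (app_lam.2 ⟨hδ, rfl⟩)⟩

theorem inj_of_isOrderType {x η : M} (h : IsOrderType x η) : Inj x η := by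
  obtain ⟨hη, F, hF, hen⟩ := isOrderType_iff.1 h
  exact hen.inj_right hη

/-- Club guessing by subclubs of a given ladder system on points of uncountable cofinality. -/
theorem exists_guessing_subclubs (hθ : IsRegularCardinal θ) (hκ : IsRegularCardinal κ)
    (hθκ : θ ∈ κ) (hμ : IsCardinal μ) (hμl : IsLimitOrdinal μ) (hμκ : μ ∈ κ)
    (hDC : DependentChoice μ) (hS : IsCofinalitySet κ θ S) (hc : IsSeqOn c S)
    (hladder : ∀ δ x, App c δ x → IsClubIn x δ ∧ ∃ η ∈ μ, IsOrderType x η)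
    (hunc : ∃ w, IsOmega w ∧ w ∈ θ) :
    ∃ d : M, IsSeqOn d S ∧
      (∀ δ x y, App d δ x → App c δ y → IsClubIn x δ ∧ IsSubset x y) ∧ GuessesClubs d S κ := by
  obtain ⟨w, hw, hwθ⟩ := hunc
  -- This is c_δ ∩ E if E accumulates at δ and c_δ otherwise, hence a club of δ in both cases.
  let d : M → M → M := fun E δ => sep (ap c δ) fun x => IsLimitPt E δ → x ∈ E
  have hdd : DefFun₂ d := by
    show DefFun₂ fun E δ => sep (ap c δ) fun x => IsLimitPt E δ → x ∈ E
    infer_instance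
  have hd : ∀ E δ x, x ∈ d E δ ↔ x ∈ ap c δ ∧ (IsLimitPt E δ → x ∈ E) := fun E δ x => mem_sep
  have hcδ : ∀ δ ∈ S, IsClubIn (ap c δ) δ ∧ ∃ η ∈ μ, IsOrderType (ap c δ) η := fun δ hδ =>
    hladder δ _ (hc.app_ap hδ)
  have hclub : ∀ E, IsClubIn E κ → ∀ δ ∈ S, IsClubIn (d E δ) δ := by
    intro E hE δ hδ
    obtain ⟨hδκ, hδθ⟩ := (hS δ).1 hδ
    have hδo := hκ.1.1.mem hδκ
    have hcof : HasCof δ θ := ⟨hδo, hθ.1, hθ.2.1, hδθ⟩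
    by_cases hlim : IsLimitPt E δ
    -- The two clubs c_δ and E ∩ δ as a family indexed by 2 = {0, 1}, to which
    -- `HasCof.isClubIn_inter` applies.
    · let D : M → M := fun i => sep δ fun x => (i = emp M → x ∈ ap c δ) ∧ (i ≠ emp M → x ∈ E)
      have hDd : DefFun₁ D := by
        show DefFun₁ fun i =>
          sep δ fun x => (i = emp M → x ∈ ap c δ) ∧ (i ≠ emp M → x ∈ E)
        infer_instance
      have h1 : succ (emp M) ≠ emp M := fun h => by
        have : emp M ∈ succ (emp M) := by simp
        rw [h] at this
        exact notMem_emp this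
      have hD0 : ∀ x, x ∈ D (emp M) ↔ x ∈ ap c δ := fun x => by
        refine mem_sep.trans ⟨fun h => h.2.1 rfl, fun h => ⟨(hcδ δ hδ).1.1.1 x h, fun _ => h, ?_⟩⟩
        exact fun h => absurd rfl h
      have hD1 : ∀ i, i ≠ emp M → ∀ x, x ∈ D i ↔ x ∈ δ ∧ x ∈ E := fun i hi x => by
        refine mem_sep.trans ⟨fun h => ⟨h.1, h.2.2 hi⟩, fun h => ⟨h.1, ?_, fun _ => h.2⟩⟩
        exact fun h => absurd h hi
      have hD : ∀ i, IsClubIn (D i) δ := by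
        intro i
        by_cases hi : i = emp M
        · rw [hi, ext_mem hD0]
          exact (hcδ δ hδ).1
        · refine ⟨⟨fun x hx => ((hD1 i hi x).1 hx).1, fun α hα => ?_⟩, fun α hα hne h => ?_⟩
          · obtain ⟨γ, hγE, hγδ, hαγ⟩ := hlim α hα
            exact ⟨γ, (hD1 i hi γ).2 ⟨hγδ, hγE⟩, Or.inl hαγ⟩
          · refine (hD1 i hi α).2 ⟨hα, hE.2 α (hκ.1.1.trans hα hδκ) hne fun β hβ => ?_⟩
            obtain ⟨γ, hγ, h'⟩ := h β hβ
            exact ⟨γ, ((hD1 i hi γ).1 hγ).2, h'⟩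
      have h2 : succ (succ (emp M)) ∈ θ := hθ.2.1.succ_mem (hθ.2.1.succ_mem hθ.2.1.emp_mem)
      have := hcof.isClubIn_inter hw hwθ h2 D fun i _ => hD i
      convert this using 1
      refine ext_mem fun x => ?_
      rw [hd, mem_sep]
      constructor
      · rintro ⟨hx, hxE⟩
        refine ⟨(hcδ δ hδ).1.1.1 x hx, fun i _ => ?_⟩
        by_cases hi : i = emp M
        · rw [hi, hD0]
          exact hx
        · exact (hD1 i hi x).2 ⟨(hcδ δ hδ).1.1.1 x hx, hxE hlim⟩
      · rintro ⟨hx, h⟩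
        exact ⟨(hD0 x).1 (h _ (by simp)), fun _ => ((hD1 _ h1 x).1 (h _ (by simp))).2⟩
    · convert (hcδ δ hδ).1 using 1
      refine ext_mem fun x => ?_
      rw [hd]
      simp [hlim]
  by_contra hcon
  have hno : ∀ E, IsClubIn E κ → ∃ D, IsClubIn D κ ∧ ∀ δ ∈ S, ¬ IsSubset (d E δ) D := by
    intro E hE
    refine exists_club_of_not_guessesClubs fun hg => hcon ⟨_, isSeqOn_lam, fun δ x y hx hy => ?_, hg⟩
    obtain ⟨hδ, rfl⟩ := app_lam.1 hx
    obtain ⟨-, rfl⟩ := hc.app_iff.1 hy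
    exact ⟨hclub E hE δ hδ, fun z hz => ((hd E δ z).1 hz).1⟩
  obtain ⟨D, δ, hDd, hδ, hD⟩ := exists_counterexamples hθ hκ hθκ hμl hμκ hDC hS d hno
  obtain ⟨hcl, η, hη, hot⟩ := hcδ δ hδ
  have hδo := hκ.1.1.mem ((hS δ).1 hδ).1
  let P : M → M → Prop := fun α x =>
    x ∈ ap c δ ∧ x ∈ (sep κ fun x => ∀ β, β ∈ α → x ∈ D β) ∧ x ∉ D α
  have hPd : DefProp₂ P := by
    show DefProp₂ fun α x =>
      x ∈ ap c δ ∧ x ∈ (sep κ fun x => ∀ β, β ∈ α → x ∈ D β) ∧ x ∉ D α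
    infer_instance
  have hP : ∀ α ∈ μ, IsLeast (fun x => P α x) (least fun x => P α x) := by
    intro α hα
    obtain ⟨-, hlim, hsub⟩ := hD α hα
    rw [IsSubset] at hsub
    push Not at hsub
    obtain ⟨x, hx, hxD⟩ := hsub
    obtain ⟨hxc, hxE⟩ := (hd _ _ _).1 hx
    exact least_spec (P := fun x => P α x) (hδo.mem (hcl.1.1 x hxc)) ⟨hxc, hxE hlim, hxD⟩
  -- The point chosen at stage α avoids D_α, while every later one lies in it.
  have hne : ∀ α ∈ μ, ∀ β ∈ μ, α ∈ β →
      least (fun x => P α x) ≠ least (fun x => P β x) := by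
    intro α hα β hβ hαβ heq
    have h1 := (hP α hα).2.1.2.2
    rw [heq] at h1
    exact h1 ((mem_sep.1 (hP β hβ).2.1.2.1).2 α hαβ)
  refine hμ.not_inj hη (Inj.trans ?_ (inj_of_isOrderType hot))
  refine ⟨fun α => least fun x => P α x, inferInstance, fun α hα => (hP α hα).2.1.1, ?_⟩
  intro α hα β hβ heq
  rcases ord_trichotomy (hμ.1.mem hα) (hμ.1.mem hβ) with h | h | h
  · exact absurd heq (hne α hα β hβ h)
  · exact h
  · exact absurd heq.symm (hne β hβ α hα h)

/-- Club guessing on points of cofinality `ω`. -/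
theorem exists_guessing_omega (hθ : IsRegularCardinal θ) (hκ : IsRegularCardinal κ)
    (hθκ : θ ∈ κ) (hμ : IsSuccCardinal θ μ) (hμl : IsLimitOrdinal μ) (hμκ : μ ∈ κ)
    (hDC : DependentChoice μ) (hS : IsCofinalitySet κ θ S) (hc : IsSeqOn c S)
    (hladder : ∀ δ x, App c δ x → IsClubIn x δ ∧ ∃ η ∈ μ, IsOrderType x η)
    (hω : IsOmega θ) :
    ∃ d : M, IsSeqOn d S ∧ (∀ δ x, App d δ x → IsCofinalIn x δ) ∧ GuessesClubs d S κ := by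
  -- The drops of the points of c_δ into E; if E does not accumulate at δ, the default is all of δ.
  let d : M → M → M := fun E δ => sep δ fun x => IsLimitPt E δ → ∃ γ, γ ∈ ap c δ ∧ IsDrop E γ x
  have hdd : DefFun₂ d := by
    show DefFun₂ fun E δ => sep δ fun x => IsLimitPt E δ → ∃ γ, γ ∈ ap c δ ∧ IsDrop E γ x
    infer_instance
  have hd : ∀ E δ x, x ∈ d E δ ↔ x ∈ δ ∧ (IsLimitPt E δ → ∃ γ, γ ∈ ap c δ ∧ IsDrop E γ x) :=
    fun E δ x => mem_sep
  have hcδ : ∀ δ ∈ S, IsClubIn (ap c δ) δ ∧ ∃ η ∈ μ, IsOrderType (ap c δ) η := fun δ hδ =>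
    hladder δ _ (hc.app_ap hδ)
  have hcof : ∀ E, IsClubIn E κ → ∀ δ ∈ S, IsCofinalIn (d E δ) δ := by
    intro E hE δ hδ
    have hδκ := ((hS δ).1 hδ).1
    have hδo := hκ.1.1.mem hδκ
    refine ⟨fun x hx => ((hd E δ x).1 hx).1, fun α hα => ?_⟩
    by_cases hlim : IsLimitPt E δ
    · obtain ⟨b, hbE, hbδ, hαb⟩ := hlim α hα
      obtain ⟨γ, hγ, hbγ⟩ := (hcδ δ hδ).1.1.2 b hbδ
      have hγδ := (hcδ δ hδ).1.1.1 γ hγ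
      obtain ⟨x, hx⟩ := hE.exists_isDrop hκ.1.1 (hκ.1.1.trans hγδ hδκ) hbE hbγ
      have hxδ : x ∈ δ := by
        rcases hx.2.1 with h | rfl
        · exact hδo.trans h hγδ
        · exact hγδ
      refine ⟨x, (hd E δ x).2 ⟨hxδ, fun _ => ⟨γ, hγ, hx⟩⟩, Or.inl ?_⟩
      rcases hx.2.2 b hbE hbγ with h | rfl
      · exact (hδo.mem hxδ).trans hαb h
      · exact hαb
    · exact ⟨α, (hd E δ α).2 ⟨hα, fun h => absurd h hlim⟩, Or.inr rfl⟩
  by_contra hcon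
  have hno : ∀ E, IsClubIn E κ → ∃ D, IsClubIn D κ ∧ ∀ δ ∈ S, ¬ IsSubset (d E δ) D := by
    intro E hE
    refine exists_club_of_not_guessesClubs fun hg => hcon ⟨_, isSeqOn_lam, fun δ x hx => ?_, hg⟩
    obtain ⟨hδ, rfl⟩ := app_lam.1 hx
    exact hcof E hE δ hδ
  obtain ⟨D, δ, hDd, hδ, hD⟩ := exists_counterexamples hθ hκ hθκ hμl hμκ hDC hS d hno
  obtain ⟨hcl, η, hη, hot⟩ := hcδ δ hδ
  have hδκ := ((hS δ).1 hδ).1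
  have hδo := hκ.1.1.mem hδκ
  obtain ⟨g, hgd, hgθ, hgi⟩ := (inj_of_isOrderType hot).trans (hμ.inj hη)
  let E : M → M := fun α => sep κ fun x => ∀ β, β ∈ α → x ∈ D β
  have hEd : DefFun₁ E := by
    show DefFun₁ fun α => sep κ fun x => ∀ β, β ∈ α → x ∈ D β
    infer_instance
  have hEmem : ∀ α x, x ∈ E α ↔ x ∈ κ ∧ ∀ β, β ∈ α → x ∈ D β := fun α x => mem_sep
  let P : M → M → M → Prop := fun α k x =>
    ∃ γ, γ ∈ ap c δ ∧ g γ = k ∧ IsDrop (E α) γ x ∧ x ∉ D α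
  have hPo : ∀ α k x, P α k x → IsOrdinal x := by
    rintro α k x ⟨γ, -, -, h, -⟩
    exact hκ.1.1.mem ((hEmem α x).1 h.1).1
  -- With c_δ coded in ω by `g`, this is the least code of a γ whose drop into E_α misses D_α.
  let n : M → M := fun α => least fun k => ∃ x, P α k x
  have hnd : DefFun₁ n := by
    show DefFun₁ fun α => least fun k => ∃ x γ, γ ∈ ap c δ ∧ g γ = k ∧ IsDrop (E α) γ x ∧ x ∉ D α
    infer_instance
  have hn : ∀ α ∈ μ, n α ∈ θ ∧ ∃ x, P α (n α) x := by
    intro α hα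
    obtain ⟨-, hlim, hsub⟩ := hD α hα
    rw [IsSubset] at hsub
    push Not at hsub
    obtain ⟨x, hx, hxD⟩ := hsub
    obtain ⟨γ, hγ, hxE⟩ := ((hd _ _ _).1 hx).2 hlim
    have h := (least_spec
      (P := fun k => ∃ x γ, γ ∈ ap c δ ∧ g γ = k ∧ IsDrop (E α) γ x ∧ x ∉ D α)
      (hθ.1.1.mem (hgθ γ hγ)) ⟨x, γ, hγ, rfl, hxE, hxD⟩).2.1
    refine ⟨?_, h⟩
    obtain ⟨x, γ, hγ, hgk, -⟩ := h
    change g γ = n α at hgk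
    rw [← hgk]
    exact hgθ γ hγ
  -- For the same γ, the later drop `y` lies in E_β ⊆ E_α, so y ≤ x; and y ∈ D_α while x ∉ D_α, so y
  -- ≠ x.
  have hdec : ∀ α β k x y, α ∈ β → β ∈ μ → P α k x → P β k y → y ∈ x := by
    rintro α β k x y hαβ hβ ⟨γ, hγ, hgγ, hx, hxD⟩ ⟨γ', hγ', hgγ', hy, -⟩
    have hγγ : γ' = γ := hgi _ hγ' _ hγ (hgγ'.trans hgγ.symm)
    rw [hγγ] at hy
    obtain ⟨hyκ, hyE⟩ := (hEmem β y).1 hy.1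
    have hyα : y ∈ E α :=
      (hEmem α y).2 ⟨hyκ, fun ζ hζ => hyE ζ ((hμl.1.mem hβ).trans hζ hαβ)⟩
    rcases hx.2.2 y hyα hy.2.1 with h | h
    · exact h
    · exact absurd (h ▸ hyE α hαβ) hxD
  have hinj : Inj μ θ := by
    refine inj_omega_of_finite_fibres hω hθ.1 (fun x hx => hμl.1.mem hx) n
      (fun α hα => (hn α hα).1) fun k hk B hB hne hBk => ?_
    obtain ⟨α₀, hα₀⟩ := hne
    obtain ⟨x₀, hx₀⟩ := (hn α₀ (hB α₀ hα₀)).2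
    rw [hBk α₀ hα₀] at hx₀
    -- Drops decrease along a fibre, so the stage with the least drop is the greatest element of
    -- `B`.
    have hmin := least_spec (P := fun x => ∃ α, α ∈ B ∧
      ∃ γ, γ ∈ ap c δ ∧ g γ = k ∧ IsDrop (E α) γ x ∧ x ∉ D α) (hPo _ _ _ hx₀) ⟨α₀, hα₀, hx₀⟩
    obtain ⟨α, hα, hPα⟩ := hmin.2.1
    refine ⟨α, hα, fun β hβ => ?_⟩
    refine (ord_notMem (hμl.1.mem (hB α hα)) (hμl.1.mem (hB β hβ))).1 fun hαβ => ?_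
    obtain ⟨y, hy⟩ := (hn β (hB β hβ)).2
    rw [hBk β hβ] at hy
    exact hmin.2.2 y (hdec α β k _ y hαβ (hB β hβ) hPα hy) ⟨β, hβ, hy⟩
  exact hμ.1.not_inj hμ.2.1 hinj

theorem succ_inj {x y : M} (h : succ x = succ y) : x = y := by
  have h1 : x ∈ succ y := h ▸ mem_succ.2 (Or.inr rfl)
  have h2 : y ∈ succ x := h ▸ mem_succ.2 (Or.inr rfl)
  rcases mem_succ.1 h1 with h1 | h1
  · rcases mem_succ.1 h2 with h2 | h2
    · exact absurd h1 (mem_asymm h2)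
    · exact h2.symm
  · exact h1

/-- If μ had a largest element β, an injection of β into θ, shifted by one to free the value 0 for
β, would inject μ into θ. -/
theorem IsSuccCardinal.isLimitOrdinal (hθ : IsLimitOrdinal θ) (hμ : IsSuccCardinal θ μ) :
    IsLimitOrdinal μ := by
  refine ⟨hμ.1.1, ⟨θ, hμ.2.1⟩, fun β hβ => ?_⟩
  by_contra! hcon
  have hβμ : ∀ x ∈ μ, x ∈ β ∨ x = β := fun x hx =>
    (ord_notMem (hμ.1.1.mem hβ) (hμ.1.1.mem hx)).1 (hcon x hx)
  obtain ⟨F, hF, hFθ, hFi⟩ := hμ.inj hβ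
  let G : M → M := fun x => iota fun y => (x = β ∧ y = emp M) ∨ (x ≠ β ∧ y = succ (F x))
  have hGd : DefFun₁ G := by
    show DefFun₁ fun x => iota fun y => (x = β ∧ y = emp M) ∨ (x ≠ β ∧ y = succ (F x))
    infer_instance
  have hGβ : G β = emp M := iota_eq (Or.inl ⟨rfl, rfl⟩) (by rintro z (h | h) <;> grind)
  have hG : ∀ x ∈ β, G x = succ (F x) := by
    intro x hx
    have hne : x ≠ β := fun h => mem_irrefl (h ▸ hx)
    exact iota_eq (Or.inr ⟨hne, rfl⟩) (by rintro z (h | h) <;> grind)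
  have hne : ∀ x, emp M ≠ succ x := fun x h => by
    have : x ∈ succ x := by simp
    rw [← h] at this
    exact notMem_emp this
  refine hμ.1.not_inj hμ.2.1 ⟨G, hGd, fun x hx => ?_, fun x hx y hy hxy => ?_⟩
  · rcases hβμ x hx with h | rfl
    · rw [hG x h]
      exact hθ.succ_mem (hFθ x h)
    · rw [hGβ]
      exact hθ.emp_mem
  · rcases hβμ x hx with h | rfl <;> rcases hβμ y hy with h' | rfl
    · rw [hG x h, hG y h'] at hxy
      exact hFi x h y h' (succ_inj hxy)
    · rw [hG x h, hGβ] at hxy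
      exact absurd hxy.symm (hne _)
    · rw [hG y h', hGβ] at hxy
      exact absurd hxy (hne _)
    · rfl

end Guessing

end ZFModel

theorem theorem4p1 {M : Type*} [Membership M M] (hZF : ModelsZF M)
    (θ θplus lam : M)
    (hθ : IsRegularCardinal θ) (hlam : IsRegularCardinal lam) (hθlam : θ ∈ lam)
    (hθplus : IsSuccCardinal θ θplus) (hθpluslam : θplus ∈ lam)
    (hDC : DependentChoice θplus)
    (S : M) (hS : IsCofinalitySet lam θ S)
    (c : M) (hc : IsSeqOn c S)
    (hladder : ∀ δ x, App c δ x → IsClubIn x δ ∧ ∃ η ∈ θplus, IsOrderType x η) :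
    (∃ d : M, IsSeqOn d S ∧ (∀ δ x, App d δ x → IsCofinalIn x δ) ∧ GuessesClubs d S lam) ∧
    (IsUncountable θ →
      ∃ d : M, IsSeqOn d S ∧
        (∀ δ x y, App d δ x → App c δ y → IsClubIn x δ ∧ IsSubset x y) ∧
        GuessesClubs d S lam) := by
  have : ZF M := ⟨hZF⟩
  have hlim := hθplus.isLimitOrdinal hθ.2.1
  -- For uncountable θ the subclubs serve both claims; for θ = ω the second claim is vacuous.
  rcases isUncountable_or_isOmega hθ with ⟨-, hunc⟩ | ⟨hcount, hω⟩
  · obtain ⟨d, hd, hdc, hg⟩ := exists_guessing_subclubs hθ hlam hθlam hθplus.1 hlim hθpluslam hDC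
      hS hc hladder hunc
    refine ⟨⟨d, hd, fun δ x hx => ?_, hg⟩, fun _ => ⟨d, hd, hdc, hg⟩⟩
    exact (hdc δ x _ hx (hc.app_ap ((hd.2 δ).2 ⟨x, hx⟩))).1.1
  · exact ⟨exists_guessing_omega hθ hlam hθlam hθplus hlim hθpluslam hDC hS hc hladder hω,
      fun h => absurd h hcount⟩
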